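/- Consider the real RAM: a machine with finitely many index registers (holding natural numbers, which can be set to constants, copied, incremented, decremented and compared), finitely many real registers (supporting rational constants, copying, exact $+,-,\times,\div$ and comparisons; a division by zero is not allowed), and finitely many real arrays addressed through index registers, where every elementary instruction and every comparison costs one step. There are one program $\mathcal A$ for this machine and one constant $C$ such that the following holds for every $n\ge 3$ and every convex polygon $P\subset\mathbb R^2$ with exactly $n$ vertices (no three of them collinear). Given $n$ and the coordinates of the vertices of $P$ in counterclockwise order, $\mathcal A$ stops after at most $C\cdot n$ steps, and its output consists of (a) the four corners, in counterclockwise order, of a quadrilateral of largest area contained in $P$, and (b) the four corners, in cyclic order, of a parallelogram of smallest area enclosing $P$. Thus both a largest-area quadrilateral contained in a convex polygon with $n$ vertices and a smallest-area parallelogram enclosing it can be found, even simultaneously, in $O(n)$ time. (Here a quadrilateral is convex and may be degenerate: some corners may coincide or lie on the line through two others. The maximum in (a) is over all quadruples of points in $P$, the area of a quadruple being the area of its convex hull; this covers also nonconvex quadrilaterals, which lie in the convex hull of their corners.) -/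

import Mathlib

/-! ### The real RAM

A real RAM has index registers holding natural numbers, real registers, and real arrays that are
addressed through index registers. A program is a finite structured text over unit-cost
instructions. There is no conversion between reals and indices, no rounding and no root extraction.
Index registers can only be set to constants, copied, incremented and decremented. -/

namespace RealRAM

/-- A memory configuration. -/
structure State where
  /-- index registers -/
  idx : ℕ → ℕ
  /-- real registers -/
  reg : ℕ → ℝ
  /-- real arrays: `arr a k` is the cell number `k` of the array number `a` -/
  arr : ℕ → ℕ → ℝ

/-- Elementary instructions; all the arguments are constants of the program text. -/
inductive Instr where
  | skip
  | idxConst (i k : ℕ)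
  | idxCopy (i j : ℕ)
  | idxInc (i : ℕ)
  | idxDec (i : ℕ)
  | const (r : ℕ) (q : ℚ)
  | copy (r s : ℕ)
  | add (r s t : ℕ)
  | sub (r s t : ℕ)
  | mul (r s t : ℕ)
  | div (r s t : ℕ)
  | load (r a i : ℕ)
  | store (a i r : ℕ)

/-- An instruction can be carried out, unless it is a division by zero. -/
def Instr.Safe : Instr → State → Prop
  | .div _ _ t, σ => σ.reg t ≠ 0
  | _, _ => True

/-- The effect of an instruction on the memory. -/
noncomputable def Instr.apply : Instr → State → State
  | .skip, σ => σ
  | .idxConst i k, σ => { σ with idx := Function.update σ.idx i k }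
  | .idxCopy i j, σ => { σ with idx := Function.update σ.idx i (σ.idx j) }
  | .idxInc i, σ => { σ with idx := Function.update σ.idx i (σ.idx i + 1) }
  | .idxDec i, σ => { σ with idx := Function.update σ.idx i (σ.idx i - 1) }
  | .const r q, σ => { σ with reg := Function.update σ.reg r (q : ℝ) }
  | .copy r s, σ => { σ with reg := Function.update σ.reg r (σ.reg s) }
  | .add r s t, σ => { σ with reg := Function.update σ.reg r (σ.reg s + σ.reg t) }
  | .sub r s t, σ => { σ with reg := Function.update σ.reg r (σ.reg s - σ.reg t) }
  | .mul r s t, σ => { σ with reg := Function.update σ.reg r (σ.reg s * σ.reg t) }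
  | .div r s t, σ => { σ with reg := Function.update σ.reg r (σ.reg s / σ.reg t) }
  | .load r a i, σ => { σ with reg := Function.update σ.reg r (σ.arr a (σ.idx i)) }
  | .store a i r, σ =>
      { σ with arr := Function.update σ.arr a (Function.update (σ.arr a) (σ.idx i) (σ.reg r)) }

/-- Elementary comparisons. -/
inductive Test where
  | idxEq (i j : ℕ)
  | idxNe (i j : ℕ)
  | idxLt (i j : ℕ)
  | idxLe (i j : ℕ)
  | realLt (r s : ℕ)
  | realLe (r s : ℕ)

/-- The outcome of a comparison. -/
def Test.Holds : Test → State → Prop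
  | .idxEq i j, σ => σ.idx i = σ.idx j
  | .idxNe i j, σ => σ.idx i ≠ σ.idx j
  | .idxLt i j, σ => σ.idx i < σ.idx j
  | .idxLe i j, σ => σ.idx i ≤ σ.idx j
  | .realLt r s, σ => σ.reg r < σ.reg s
  | .realLe r s, σ => σ.reg r ≤ σ.reg s

/-- Programs. -/
inductive Program where
  | instr (c : Instr)
  | seq (P Q : Program)
  | ite (b : Test) (P Q : Program)
  | loop (b : Test) (P : Program)

/-- `Exec P σ τ k`: started in the memory configuration `σ`, the program `P` terminates in the
memory configuration `τ` after exactly `k` steps, where each elementary instruction that is carried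
out and each comparison that is evaluated (in a conditional or at the head of a `while` loop)
counts as one step. -/
inductive Exec : Program → State → State → ℕ → Prop where
  | instr (c : Instr) (σ : State) (h : c.Safe σ) : Exec (.instr c) σ (c.apply σ) 1
  | seq {P Q : Program} {σ τ υ : State} {k l : ℕ}
      (h₁ : Exec P σ τ k) (h₂ : Exec Q τ υ l) : Exec (.seq P Q) σ υ (k + l)
  | ite_true {b : Test} {P Q : Program} {σ τ : State} {k : ℕ}
      (hb : b.Holds σ) (h : Exec P σ τ k) : Exec (.ite b P Q) σ τ (k + 1)
  | ite_false {b : Test} {P Q : Program} {σ τ : State} {k : ℕ}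
      (hb : ¬ b.Holds σ) (h : Exec Q σ τ k) : Exec (.ite b P Q) σ τ (k + 1)
  | loop_true {b : Test} {P : Program} {σ τ υ : State} {k l : ℕ}
      (hb : b.Holds σ) (h₁ : Exec P σ τ k) (h₂ : Exec (.loop b P) τ υ l) :
      Exec (.loop b P) σ υ (k + l + 1)
  | loop_false {b : Test} {P : Program} {σ : State}
      (hb : ¬ b.Holds σ) : Exec (.loop b P) σ σ 1

end RealRAM

/-! ### Convex polygons, quadrilaterals and parallelograms in the plane -/

namespace ConvexPolygon

/-- Twice the signed area of the triangle `a b c`; positive iff `a`, `b`, `c` make a left turn. -/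
def orient (a b c : ℝ × ℝ) : ℝ :=
  (b.1 - a.1) * (c.2 - a.2) - (c.1 - a.1) * (b.2 - a.2)

/-- `p 0, …, p (n - 1)` are the `n ≥ 3` vertices of a convex polygon in counterclockwise order. -/
def IsVertexList {n : ℕ} (p : Fin n → ℝ × ℝ) : Prop :=
  3 ≤ n ∧ ∀ i j k : Fin n, i < j → j < k → 0 < orient (p i) (p j) (p k)

/-- The closed convex region spanned by finitely many points. -/
def region {n : ℕ} (p : Fin n → ℝ × ℝ) : Set (ℝ × ℝ) :=
  convexHull ℝ (Set.range p)

/-- The area (two-dimensional Lebesgue measure) of the region spanned by finitely many points. -/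
noncomputable def area {n : ℕ} (p : Fin n → ℝ × ℝ) : ENNReal :=
  MeasureTheory.volume (region p)

/-- `F 0, F 1, F 2, F 3` are the corners of a convex quadrilateral in counterclockwise order.
The quadrilateral may be degenerate: corners may lie on the line through two others, or coincide. -/
def IsQuadrilateral (F : Fin 4 → ℝ × ℝ) : Prop :=
  ∀ i j k : Fin 4, i < j → j < k → 0 ≤ orient (F i) (F j) (F k)

/-- `F` is a quadrilateral of largest area contained in `S`. The competitors are arbitrary
quadruples of points, each with the area of its convex hull: this includes all the convex
quadrilaterals in `S`, and bounds the area of nonconvex ones. -/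
def IsLargestQuadrilateral (S : Set (ℝ × ℝ)) (F : Fin 4 → ℝ × ℝ) : Prop :=
  IsQuadrilateral F ∧ region F ⊆ S ∧
    ∀ F' : Fin 4 → ℝ × ℝ, region F' ⊆ S → area F' ≤ area F

/-- `G 0, G 1, G 2, G 3` are the consecutive corners of a (nondegenerate) parallelogram. -/
def IsParallelogram (G : Fin 4 → ℝ × ℝ) : Prop :=
  G 0 + G 2 = G 1 + G 3 ∧ orient (G 0) (G 1) (G 3) ≠ 0

/-- `G` is a parallelogram of smallest area enclosing `S`. -/
def IsSmallestParallelogram (S : Set (ℝ × ℝ)) (G : Fin 4 → ℝ × ℝ) : Prop :=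
  IsParallelogram G ∧ S ⊆ region G ∧
    ∀ G' : Fin 4 → ℝ × ℝ, IsParallelogram G' → S ⊆ region G' → area G ≤ area G'

/-- The input convention: index register `0` holds the number `n` of points, and the cells
`0, …, n - 1` of the arrays `0` and `1` hold their `x`- and `y`-coordinates. The rest of the memory
has arbitrary contents. -/
def IsInput {n : ℕ} (p : Fin n → ℝ × ℝ) (σ : RealRAM.State) : Prop :=
  σ.idx 0 = n ∧ ∀ i : Fin n, σ.arr 0 i = (p i).1 ∧ σ.arr 1 i = (p i).2

/-- The output convention: four points are read off from the eight consecutive real registers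
`r, …, r + 7`, in the order `x₀, y₀, x₁, y₁, x₂, y₂, x₃, y₃`. -/
def output (σ : RealRAM.State) (r : ℕ) (i : Fin 4) : ℝ × ℝ :=
  (σ.reg (r + 2 * (i : ℕ)), σ.reg (r + 2 * (i : ℕ) + 1))

end ConvexPolygon

/-! ### Total correctness rules that count steps. -/

namespace RealRAM

/-! Both problems live on the difference body D = S - S of the polygon S. Let a pair of parallel
supporting lines make a full turn, with contact points C t, A t and direction f t, and put k_t = C t
- A t. The points k_t run once around the boundary of D with edges f t: k_{t+1} = k_t + f t, and
k_{t+n} = -k_t. This is the structure `Calipers`. If S has parallel edges, consecutive f t may be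
parallel, and then k_t may lie inside a side of D. The data are found in linear time
(`calipers_merge`): the edges of the right chain of S and the negated edges of the left chain are
both sorted by angle, and merging them gives half a turn.

Largest quadrilateral: four points a, b, c, d of S span at most half the largest value of cross (c -
a) (d - b) over S, with equality for a counterclockwise quadrilateral. So a bilinear form is
maximized over D × D. Fixing one argument at a time, the first may be taken to be some k_j, and the
second a conjugate k_{i+1}, where cross k_j (f i) > 0 ≥ cross k_j (f (i + 1))
(`cross_le_of_conjugate`).

Smallest parallelogram: one with sides u, v encloses S only if cross u and cross v are bounded on D
by T = |cross u v|, its area. The line through 0 parallel to u meets the boundary of D on some edge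
f s, and v may be exchanged for f s without increasing the area; then u may be exchanged for the
edge f j met by the line parallel to f s (`width_mul_le`, `le_of_enclosing`). What remains are the
areas w_i w_j / cross (f j) (f i), w_t = cross k_t (f t), over pairs with cross k_j (f i) ≤ 0 ≤
cross k_{j+1} (f i).

Both conditions concern the sign of cross k_j (f i). It turns nonpositive as i grows and positive as
j grows, so the relevant pairs lie along a monotone staircase. A single walk with two increasing
indices visits all of them: each increase of j follows the test of a quadrilateral, each increase of
i that of a parallelogram. A potential linear in the two indices pays for the nested loops. -/

/-- The memory after a sequence of instructions. -/
noncomputable def run : List Instr → State → State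
  | [], σ => σ
  | c :: l, σ => run l (c.apply σ)

/-- No instruction of the sequence divides by zero. -/
def SafeList : List Instr → State → Prop
  | [], _ => True
  | c :: l, σ => c.Safe σ ∧ SafeList l (c.apply σ)

/-- Straight-line code as a program. -/
def block : List Instr → Program
  | [] => .instr .skip
  | c :: l => .seq (.instr c) (block l)

/-- `P` terminates from `σ`, and the final memory and the number of steps satisfy `Q`. -/
def Runs (P : Program) (σ : State) (Q : State → ℕ → Prop) : Prop :=
  ∃ τ k, Exec P σ τ k ∧ Q τ k

theorem Runs.mono {P : Program} {σ : State} {Q R : State → ℕ → Prop} (h : Runs P σ Q)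
    (hQR : ∀ τ k, Q τ k → R τ k) : Runs P σ R := by
  obtain ⟨τ, k, h, hq⟩ := h
  exact ⟨τ, k, h, hQR _ _ hq⟩

theorem Runs.seq {P P' : Program} {σ : State} {Q R : State → ℕ → Prop} (h : Runs P σ Q)
    (h' : ∀ τ k, Q τ k → Runs P' τ (fun υ l => R υ (k + l))) : Runs (.seq P P') σ R := by
  obtain ⟨τ, k, h, hq⟩ := h
  obtain ⟨υ, l, hl, hr⟩ := h' τ k hq
  exact ⟨υ, k + l, .seq h hl, hr⟩

theorem exec_block (l : List Instr) (σ : State) (h : SafeList l σ) :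
    Exec (block l) σ (run l σ) (l.length + 1) := by
  induction l generalizing σ with
  | nil => exact .instr .skip σ trivial
  | cons c l ih =>
    have := Exec.seq (.instr c σ h.1) (ih _ h.2)
    rwa [add_comm 1] at this

theorem Runs.block {l : List Instr} {σ : State} {Q : State → ℕ → Prop} (h : SafeList l σ)
    (hQ : Q (run l σ) (l.length + 1)) : Runs (block l) σ Q :=
  ⟨_, _, exec_block l σ h, hQ⟩

theorem Runs.ite {b : Test} {P P' : Program} {σ : State} {Q : State → ℕ → Prop}
    (h : b.Holds σ → Runs P σ (fun τ k => Q τ (k + 1)))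
    (h' : ¬ b.Holds σ → Runs P' σ (fun τ k => Q τ (k + 1))) : Runs (.ite b P P') σ Q := by
  by_cases hb : b.Holds σ
  · obtain ⟨τ, k, he, hq⟩ := h hb
    exact ⟨τ, _, .ite_true hb he, hq⟩
  · obtain ⟨τ, k, he, hq⟩ := h' hb
    exact ⟨τ, _, .ite_false hb he, hq⟩

/-- The rule for loops, with an invariant `I` and a potential `φ` that pays for the steps. -/
theorem Runs.loop {b : Test} {P : Program} (I : State → Prop) (φ : State → ℕ)
    (hP : ∀ σ, I σ → b.Holds σ → Runs P σ (fun τ k => I τ ∧ φ τ + k + 1 ≤ φ σ))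
    {σ : State} (hσ : I σ) :
    Runs (.loop b P) σ (fun τ k => I τ ∧ ¬ b.Holds τ ∧ φ τ + k ≤ φ σ + 1) := by
  induction hN : φ σ using Nat.strong_induction_on generalizing σ with
  | _ N ih =>
    by_cases hb : b.Holds σ
    · obtain ⟨τ, k, he, hI, hk⟩ := hP σ hσ hb
      obtain ⟨υ, l, he', hI', hb', hl⟩ := ih (φ τ) (by omega) hI rfl
      exact ⟨υ, _, .loop_true hb he he', hI', hb', by omega⟩
    · exact ⟨σ, 1, .loop_false hb, hσ, hb, by omega⟩

end RealRAM

/-! ### Areas of triangles, quadrilaterals and parallelograms -/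

namespace ConvexPolygon

open MeasureTheory

/-- The signed area of the parallelogram spanned by two vectors. -/
def cross (u v : ℝ × ℝ) : ℝ := u.1 * v.2 - u.2 * v.1

theorem orient_eq_cross (a b c : ℝ × ℝ) : orient a b c = cross (b - a) (c - a) := by
  simp only [orient, cross, Prod.fst_sub, Prod.snd_sub]
  ring

theorem mem_region_iff {n : ℕ} (p : Fin n → ℝ × ℝ) (x : ℝ × ℝ) :
    x ∈ region p ↔ ∃ w : Fin n → ℝ, (∀ i, 0 ≤ w i) ∧ ∑ i, w i = 1 ∧ ∑ i, w i • p i = x := by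
  constructor
  · intro hx
    refine convexHull_min (t := {x | ∃ w : Fin n → ℝ, (∀ i, 0 ≤ w i) ∧ ∑ i, w i = 1 ∧
      ∑ i, w i • p i = x}) ?_ ?_ hx
    · rintro _ ⟨i, rfl⟩
      refine ⟨Pi.single i 1, fun j => ?_, ?_, ?_⟩
      · by_cases h : j = i
        · subst h; simp
        · simp [Pi.single_eq_of_ne h]
      · simp
      · simp [Pi.single_apply, ite_smul]
    · rintro _ ⟨w, hw, hs, rfl⟩ _ ⟨w', hw', hs', rfl⟩ a b ha hb hab
      refine ⟨fun i => a * w i + b * w' i, fun i => ?_, ?_, ?_⟩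
      · have := hw i; have := hw' i; positivity
      · rw [Finset.sum_add_distrib, ← Finset.mul_sum, ← Finset.mul_sum, hs, hs']; linarith
      · simp only [add_smul, mul_smul, Finset.sum_add_distrib, Finset.smul_sum]
  · rintro ⟨w, hw, hs, rfl⟩
    exact (convex_convexHull ℝ _).sum_mem (fun i _ => hw i) hs
      (fun i _ => subset_convexHull ℝ _ ⟨i, rfl⟩)

/-- The linear map with columns `u` and `v`. -/
noncomputable def colMap (u v : ℝ × ℝ) : ℝ × ℝ →ₗ[ℝ] ℝ × ℝ :=
  (LinearMap.fst ℝ ℝ ℝ).smulRight u + (LinearMap.snd ℝ ℝ ℝ).smulRight v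

theorem colMap_apply (u v x : ℝ × ℝ) : colMap u v x = x.1 • u + x.2 • v := rfl

theorem det_colMap (u v : ℝ × ℝ) : LinearMap.det (colMap u v) = cross u v := by
  rw [← LinearMap.det_toMatrix (Module.Basis.finTwoProd ℝ), Matrix.det_fin_two]
  simp [LinearMap.toMatrix_apply, colMap_apply, cross]
  ring

theorem volume_colMap_image (a u v : ℝ × ℝ) (s : Set (ℝ × ℝ)) :
    volume ((fun x => a + colMap u v x) '' s) = ENNReal.ofReal |cross u v| * volume s := by
  rw [← det_colMap, ← Measure.addHaar_image_linearMap volume, ← Set.image_image (fun x => a + x),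
    Set.image_add_left, measure_preimage_add]

theorem convexHull_colMap_image (a u v : ℝ × ℝ) (s : Set (ℝ × ℝ)) :
    convexHull ℝ ((fun x => a + colMap u v x) '' s) =
      (fun x => a + colMap u v x) '' convexHull ℝ s := by
  have := (AffineMap.const ℝ (ℝ × ℝ) a + (colMap u v).toAffineMap).image_convexHull s
  exact this.symm

/-- The area of a reference triangle. -/
noncomputable def unitTriangleArea : ENNReal :=
  volume (convexHull ℝ {((0 : ℝ), (0 : ℝ)), (1, 0), (0, 1)})

/-- Affine image of the reference triangle. The value of `unitTriangleArea` is never needed, since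
areas of quadrilaterals are only compared. -/
theorem volume_triangle (a b c : ℝ × ℝ) :
    volume (convexHull ℝ {a, b, c}) = ENNReal.ofReal |orient a b c| * unitTriangleArea := by
  rw [orient_eq_cross, unitTriangleArea, ← volume_colMap_image a, ← convexHull_colMap_image]
  congr 2
  simp [Set.image_insert_eq, colMap_apply]

/-- Affine image of the unit square, whose area is again only a common factor. -/
theorem area_parallelogram {G : Fin 4 → ℝ × ℝ} (hG : G 0 + G 2 = G 1 + G 3) :
    area G = ENNReal.ofReal |orient (G 0) (G 1) (G 3)| *
      volume (convexHull ℝ {((0 : ℝ), (0 : ℝ)), (1, 0), (1, 1), (0, 1)}) := by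
  rw [orient_eq_cross, ← volume_colMap_image (G 0), ← convexHull_colMap_image, area, region]
  congr 2
  have h2 : G 0 + (G 1 - G 0 + (G 3 - G 0)) = G 2 := by
    rw [add_comm] at hG
    rw [eq_sub_of_add_eq hG]; abel
  simp only [Set.image_insert_eq, Set.image_singleton, colMap_apply, zero_smul, one_smul, add_zero,
    zero_add, add_sub_cancel, h2]
  ext x
  simp [Fin.exists_fin_succ, eq_comm]

theorem mem_region_parallelogram {G : Fin 4 → ℝ × ℝ} (hG : G 0 + G 2 = G 1 + G 3) (x : ℝ × ℝ) :
    x ∈ region G ↔ ∃ s t : ℝ, 0 ≤ s ∧ s ≤ 1 ∧ 0 ≤ t ∧ t ≤ 1 ∧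
      x = G 0 + s • (G 1 - G 0) + t • (G 3 - G 0) := by
  have e1 := congrArg Prod.fst hG
  have e2 := congrArg Prod.snd hG
  simp only [Prod.fst_add, Prod.snd_add] at e1 e2
  rw [mem_region_iff]
  constructor
  · rintro ⟨w, hw, hs, rfl⟩
    rw [Fin.sum_univ_four] at hs
    have := hw 0; have := hw 1; have := hw 2; have := hw 3
    refine ⟨w 1 + w 2, w 2 + w 3, by linarith, by linarith, by linarith, by linarith, ?_⟩
    have h0 : w 0 = 1 - w 1 - w 2 - w 3 := by linarith
    have f1 : (G 2).1 = (G 1).1 + (G 3).1 - (G 0).1 := by linarith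
    have f2 : (G 2).2 = (G 1).2 + (G 3).2 - (G 0).2 := by linarith
    ext
    · simp [Fin.sum_univ_four, h0, f1]; ring
    · simp [Fin.sum_univ_four, h0, f2]; ring
  · rintro ⟨s, t, hs, hs', ht, ht', rfl⟩
    refine ⟨![(1 - s) * (1 - t), s * (1 - t), s * t, (1 - s) * t], ?_, ?_, ?_⟩
    · have := sub_nonneg.2 hs'; have := sub_nonneg.2 ht'
      intro i; fin_cases i <;> simp <;> positivity
    · simp [Fin.sum_univ_four]; ring
    · have f1 : (G 2).1 = (G 1).1 + (G 3).1 - (G 0).1 := by linarith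
      have f2 : (G 2).2 = (G 1).2 + (G 3).2 - (G 0).2 := by linarith
      ext
      · simp [Fin.sum_univ_four, f1]; ring
      · simp [Fin.sum_univ_four, f2]; ring

theorem range_fin_four {α : Type*} (F : Fin 4 → α) : Set.range F = {F 0, F 1, F 2, F 3} := by
  ext x
  simp [Fin.exists_fin_succ, eq_comm]

theorem mem_convexHull_triangle {a b c x : ℝ × ℝ} {u v w : ℝ} (hu : 0 ≤ u) (hv : 0 ≤ v)
    (hw : 0 ≤ w) (hs : u + v + w = 1) (hx : u • a + v • b + w • c = x) :
    x ∈ convexHull ℝ {a, b, c} := by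
  have : x ∈ region ![a, b, c] := by
    rw [mem_region_iff]
    refine ⟨![u, v, w], ?_, ?_, ?_⟩
    · intro i; fin_cases i <;> simpa
    · simpa [Fin.sum_univ_three] using hs
    · simpa [Fin.sum_univ_three] using hx
  rw [region] at this
  convert this using 2
  ext y
  simp only [Set.mem_insert_iff, Set.mem_singleton_iff, Set.mem_range, Fin.exists_fin_succ,
    eq_comm (b := y)]
  simp

theorem exists_weights_of_mem_convexHull {a b c d x : ℝ × ℝ} (hx : x ∈ convexHull ℝ {a, b, c, d}) :
    ∃ s t u v : ℝ, 0 ≤ s ∧ 0 ≤ t ∧ 0 ≤ u ∧ 0 ≤ v ∧ s + t + u + v = 1 ∧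
      s • a + t • b + u • c + v • d = x := by
  have h : x ∈ region ![a, b, c, d] := by
    rw [region, range_fin_four]; simpa using hx
  obtain ⟨w, hw, hs, hx⟩ := (mem_region_iff _ _).1 h
  rw [Fin.sum_univ_four] at hs hx
  exact ⟨w 0, w 1, w 2, w 3, hw 0, hw 1, hw 2, hw 3, hs, by simpa using hx⟩

/-- If the segments `a c` and `b d` meet, the hull of the four points is covered by the two
triangles `a b c` and `a c d`. -/
theorem convexHull_subset_union_triangles {a b c d : ℝ × ℝ} {α β γ δ : ℝ} (hα : 0 ≤ α)
    (hβ : 0 ≤ β) (hγ : 0 ≤ γ) (hδ : 0 ≤ δ) (hs : α + γ = β + δ) (hpos : 0 < β + δ)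
    (h : α • a + γ • c = β • b + δ • d) :
    convexHull ℝ {a, b, c, d} ⊆ convexHull ℝ {a, b, c} ∪ convexHull ℝ {a, c, d} := by
  intro x hx
  obtain ⟨s, t, u, v, hs0, ht0, hu0, hv0, hsum, hx⟩ := exists_weights_of_mem_convexHull hx
  -- Adding r times the given relation changes the weights, not the point. The value of r is chosen
  -- so that the weight of d or of b vanishes, whichever comes first.
  have key : ∀ r : ℝ, (s + r * α) • a + (t - r * β) • b + (u + r * γ) • c + (v - r * δ) • d = x := by
    intro r
    have : (s + r * α) • a + (t - r * β) • b + (u + r * γ) • c + (v - r * δ) • d =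
      (s • a + t • b + u • c + v • d) + r • ((α • a + γ • c) - (β • b + δ • d)) := by module
    rw [this, h, sub_self, smul_zero, add_zero, hx]
  -- This is v / δ ≤ t / β without denominators, as β may be 0.
  by_cases hc : 0 < δ ∧ v * β ≤ t * δ
  · left
    have hd : v / δ * δ = v := div_mul_cancel₀ _ hc.1.ne'
    have hr : 0 ≤ v / δ := by positivity
    have k := key (v / δ)
    rw [hd, sub_self, zero_smul, add_zero] at k
    refine mem_convexHull_triangle (by positivity) ?_ (by positivity) ?_ k
    · rw [div_mul_eq_mul_div, sub_nonneg, div_le_iff₀ hc.1]; exact hc.2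
    · have : v / δ * (α + γ) = v / δ * (β + δ) := by rw [hs]
      linarith
  · right
    have hb : 0 < β := by
      rcases hδ.lt_or_eq with h1 | h1
      · by_contra hb
        apply hc
        refine ⟨h1, ?_⟩
        rw [le_antisymm (not_lt.1 hb) hβ]; simp; positivity
      · linarith
    have hle : t * δ ≤ v * β := by
      by_contra hlt
      rw [not_le] at hlt
      apply hc
      refine ⟨?_, hlt.le⟩
      rcases hδ.lt_or_eq with h1 | h1
      · exact h1
      · rw [← h1, mul_zero] at hlt; nlinarith
    have hd : t / β * β = t := div_mul_cancel₀ _ hb.ne'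
    have hr : 0 ≤ t / β := by positivity
    have k := key (t / β)
    rw [hd, sub_self, zero_smul, add_zero] at k
    refine mem_convexHull_triangle (by positivity) (by positivity) ?_ ?_ k
    · rw [div_mul_eq_mul_div, sub_nonneg, div_le_iff₀ hb]; exact hle
    · have : t / β * (α + γ) = t / β * (β + δ) := by rw [hs]
      linarith

theorem convexHull_subset_triangle {a b c d : ℝ × ℝ} {α β γ : ℝ} (hα : 0 ≤ α)
    (hβ : 0 ≤ β) (hγ : 0 ≤ γ) (hpos : 0 < α + β + γ)
    (h : α • a + β • b + γ • c = (α + β + γ) • d) :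
    convexHull ℝ {a, b, c, d} ⊆ convexHull ℝ {a, b, c} := by
  refine convexHull_min ?_ (convex_convexHull ℝ _)
  have hd : d ∈ convexHull ℝ {a, b, c} := by
    refine mem_convexHull_triangle (u := α / (α + β + γ)) (v := β / (α + β + γ))
      (w := γ / (α + β + γ)) (by positivity) (by positivity) (by positivity) (by field_simp) ?_
    have : d = (α + β + γ)⁻¹ • (α • a + β • b + γ • c) := by
      rw [h, smul_smul, inv_mul_cancel₀ hpos.ne', one_smul]
    rw [this]
    module
  have hm := subset_convexHull ℝ ({a, b, c} : Set (ℝ × ℝ))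
  rintro x (rfl | rfl | rfl | rfl)
  · exact hm (by simp)
  · exact hm (by simp)
  · exact hm (by simp)
  · exact hd

/-- The relation puts b and d on opposite sides of the line through a and c (`hz`), so the areas of
the two covering triangles add up to |cross (c - a) (d - b)|. If one of the weights β, δ is 0, the
other is positive and the triangle belonging to it is flat. -/
theorem volume_convexHull_le_of_crossing {a b c d : ℝ × ℝ} {α β γ δ M : ℝ} (hα : 0 ≤ α)
    (hβ : 0 ≤ β) (hγ : 0 ≤ γ) (hδ : 0 ≤ δ) (hs : α + γ = β + δ) (hpos : 0 < β + δ)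
    (h : α • a + γ • c = β • b + δ • d) (hM : |cross (c - a) (d - b)| ≤ M) :
    volume (convexHull ℝ {a, b, c, d}) ≤ ENNReal.ofReal M * unitTriangleArea := by
  refine (measure_mono (convexHull_subset_union_triangles hα hβ hγ hδ hs hpos h)).trans
    ((measure_union_le _ _).trans ?_)
  rw [volume_triangle, volume_triangle, ← add_mul, ← ENNReal.ofReal_add (abs_nonneg _) (abs_nonneg _)]
  gcongr
  refine le_trans ?_ hM
  have e1 := congrArg Prod.fst h
  have e2 := congrArg Prod.snd h
  simp only [Prod.fst_add, Prod.snd_add, Prod.smul_fst, Prod.smul_snd, smul_eq_mul] at e1 e2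
  have hz : β * orient a b c = δ * orient a c d := by
    simp only [orient]
    linear_combination (-c.2 + a.2) * e1 + (c.1 - a.1) * e2 +
      (a.1 * (-c.2 + a.2) + a.2 * (c.1 - a.1)) * (hs * (-1))
  have hsum : cross (c - a) (d - b) = orient a b c + orient a c d := by
    simp only [orient, cross, Prod.fst_sub, Prod.snd_sub]; ring
  rw [hsum]
  apply le_of_eq
  symm
  rw [abs_add_eq_add_abs_iff]
  rcases le_total 0 (orient a b c) with h1 | h1 <;> rcases le_total 0 (orient a c d) with h2 | h2
  · exact Or.inl ⟨h1, h2⟩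
  · have := mul_nonneg hβ h1
    have := mul_nonneg hδ (neg_nonneg.2 h2)
    have hb : β * orient a b c = 0 := by linarith
    have hd : δ * orient a c d = 0 := by linarith
    rcases mul_eq_zero.1 hb with h3 | h3
    · rcases mul_eq_zero.1 hd with h4 | h4
      · linarith
      · exact Or.inl ⟨h1, h4.ge⟩
    · exact Or.inr ⟨h3.le, h2⟩
  · have := mul_nonneg hβ (neg_nonneg.2 h1)
    have := mul_nonneg hδ h2
    have hb : β * orient a b c = 0 := by linarith
    have hd : δ * orient a c d = 0 := by linarith
    rcases mul_eq_zero.1 hb with h3 | h3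
    · rcases mul_eq_zero.1 hd with h4 | h4
      · linarith
      · exact Or.inr ⟨h1, h4.le⟩
    · exact Or.inl ⟨h3.ge, h2⟩
  · exact Or.inr ⟨h1, h2⟩

/-- Here d lies in the triangle a b c, whose area again has the form of a cross product of two
differences, now with a common corner. -/
theorem volume_convexHull_le_of_mem {a b c d : ℝ × ℝ} {α β γ M : ℝ} (hα : 0 ≤ α)
    (hβ : 0 ≤ β) (hγ : 0 ≤ γ) (hpos : 0 < α + β + γ)
    (h : α • a + β • b + γ • c = (α + β + γ) • d) (hM : |cross (c - a) (b - a)| ≤ M) :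
    volume (convexHull ℝ {a, b, c, d}) ≤ ENNReal.ofReal M * unitTriangleArea := by
  refine (measure_mono (convexHull_subset_triangle hα hβ hγ hpos h)).trans ?_
  rw [volume_triangle]
  gcongr
  rwa [orient_eq_cross, show cross (b - a) (c - a) = - cross (c - a) (b - a) by
    simp only [cross]; ring, abs_neg]

/-- Four vectors (F i, 1) in a space of dimension three are dependent; this is the relation behind
Radon's theorem. -/
theorem exists_affine_relation (F : Fin 4 → ℝ × ℝ) :
    ∃ c : Fin 4 → ℝ, (∃ i, c i ≠ 0) ∧ c 0 + c 1 + c 2 + c 3 = 0 ∧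
      c 0 • F 0 + c 1 • F 1 + c 2 • F 2 + c 3 • F 3 = 0 := by
  have : ¬ LinearIndependent ℝ (fun i => ((F i, 1) : (ℝ × ℝ) × ℝ)) := by
    intro h
    have := h.fintype_card_le_finrank
    simp at this
  obtain ⟨c, hc, hi⟩ := Fintype.not_linearIndependent_iff.1 this
  rw [Fin.sum_univ_four] at hc
  refine ⟨c, hi, ?_, ?_⟩
  · simpa using congrArg Prod.snd hc
  · simpa using congrArg Prod.fst hc

/-- The hull of four points has at most the area of the largest quadrilateral with these
corners. -/
theorem area_le_of_cross_le {F : Fin 4 → ℝ × ℝ} {M : ℝ}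
    (hM : ∀ i j k l, cross (F k - F i) (F l - F j) ≤ M) :
    area F ≤ ENNReal.ofReal M * unitTriangleArea := by
  have hM' : ∀ i j k l, |cross (F k - F i) (F l - F j)| ≤ M := by
    intro i j k l
    refine abs_le.2 ⟨?_, hM i j k l⟩
    have := hM k j i l
    simp only [cross, Prod.fst_sub, Prod.snd_sub] at this ⊢
    linarith
  obtain ⟨c, hc, hsum, hrel, h3⟩ : ∃ c : Fin 4 → ℝ, (∃ i, c i ≠ 0) ∧ c 0 + c 1 + c 2 + c 3 = 0 ∧
      c 0 • F 0 + c 1 • F 1 + c 2 • F 2 + c 3 • F 3 = 0 ∧ c 3 ≤ 0 := by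
    obtain ⟨c, ⟨i, hi⟩, hsum, hrel⟩ := exists_affine_relation F
    rcases le_total (c 3) 0 with h | h
    · exact ⟨c, ⟨i, hi⟩, hsum, hrel, h⟩
    · refine ⟨-c, ⟨i, by simpa using hi⟩, by simp; linarith, ?_, by simpa using h⟩
      rw [← neg_eq_zero, ← hrel]
      simp only [Pi.neg_apply]; module
  have hc' : ¬ (c 0 = 0 ∧ c 1 = 0 ∧ c 2 = 0 ∧ c 3 = 0) := by
    rintro ⟨a, b, d, e⟩
    obtain ⟨i, hi⟩ := hc
    fin_cases i <;> simp_all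
  rw [area, region, range_fin_four]
  have e1 := congrArg Prod.fst hrel
  have e2 := congrArg Prod.snd hrel
  simp only [Prod.fst_add, Prod.snd_add, Prod.smul_fst, Prod.smul_snd, smul_eq_mul, Prod.fst_zero,
    Prod.snd_zero] at e1 e2
  -- Radon partitions. One sign against three: a point lies in the triangle of the others. Two
  -- against two: two segments meet. Since c 3 ≤ 0, eight patterns remain, and the last one forces
  -- all coefficients to vanish.
  rcases le_total 0 (c 0) with h0 | h0 <;> rcases le_total 0 (c 1) with h1 | h1 <;>
    rcases le_total 0 (c 2) with h2 | h2
  · refine volume_convexHull_le_of_mem h0 h1 h2 ?_ ?_ (hM' _ _ _ _)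
    · by_contra h
      exact hc' ⟨by linarith, by linarith, by linarith, by linarith⟩
    · ext <;> simp <;> first | linear_combination e1 - (F 3).1 * hsum | linear_combination e2 - (F 3).2 * hsum
  · have : ({F 0, F 1, F 2, F 3} : Set (ℝ × ℝ)) = {F 0, F 2, F 1, F 3} := by
      rw [Set.insert_comm (F 1)]
    rw [this]
    refine volume_convexHull_le_of_crossing h0 (neg_nonneg.2 h2) h1 (neg_nonneg.2 h3)
      (by linarith) ?_ ?_ (hM' _ _ _ _)
    · by_contra h
      exact hc' ⟨by linarith, by linarith, by linarith, by linarith⟩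
    · ext <;> simp <;> first | linear_combination e1 | linear_combination e2
  · refine volume_convexHull_le_of_crossing h0 (neg_nonneg.2 h1) h2 (neg_nonneg.2 h3)
      (by linarith) ?_ ?_ (hM' _ _ _ _)
    · by_contra h
      exact hc' ⟨by linarith, by linarith, by linarith, by linarith⟩
    · ext <;> simp <;> first | linear_combination e1 | linear_combination e2
  · have : ({F 0, F 1, F 2, F 3} : Set (ℝ × ℝ)) = {F 1, F 2, F 3, F 0} := by
      ext x; simp only [Set.mem_insert_iff, Set.mem_singleton_iff]; tauto
    rw [this]
    refine volume_convexHull_le_of_mem (neg_nonneg.2 h1) (neg_nonneg.2 h2) (neg_nonneg.2 h3) ?_ ?_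
      (hM' _ _ _ _)
    · by_contra h
      exact hc' ⟨by linarith, by linarith, by linarith, by linarith⟩
    · ext <;> simp <;>
        first | linear_combination (F 0).1 * hsum - e1 | linear_combination (F 0).2 * hsum - e2
  · have : ({F 0, F 1, F 2, F 3} : Set (ℝ × ℝ)) = {F 1, F 0, F 2, F 3} := by
      rw [Set.insert_comm (F 0)]
    rw [this]
    refine volume_convexHull_le_of_crossing h1 (neg_nonneg.2 h0) h2 (neg_nonneg.2 h3)
      (by linarith) ?_ ?_ (hM' _ _ _ _)
    · by_contra h
      exact hc' ⟨by linarith, by linarith, by linarith, by linarith⟩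
    · ext <;> simp <;> first | linear_combination e1 | linear_combination e2
  · have : ({F 0, F 1, F 2, F 3} : Set (ℝ × ℝ)) = {F 0, F 2, F 3, F 1} := by
      ext x; simp only [Set.mem_insert_iff, Set.mem_singleton_iff]; tauto
    rw [this]
    refine volume_convexHull_le_of_mem (neg_nonneg.2 h0) (neg_nonneg.2 h2) (neg_nonneg.2 h3) ?_ ?_
      (hM' _ _ _ _)
    · by_contra h
      exact hc' ⟨by linarith, by linarith, by linarith, by linarith⟩
    · ext <;> simp <;>
        first | linear_combination (F 1).1 * hsum - e1 | linear_combination (F 1).2 * hsum - e2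
  · have : ({F 0, F 1, F 2, F 3} : Set (ℝ × ℝ)) = {F 0, F 1, F 3, F 2} := by
      ext x; simp only [Set.mem_insert_iff, Set.mem_singleton_iff]; tauto
    rw [this]
    refine volume_convexHull_le_of_mem (neg_nonneg.2 h0) (neg_nonneg.2 h1) (neg_nonneg.2 h3) ?_ ?_
      (hM' _ _ _ _)
    · by_contra h
      exact hc' ⟨by linarith, by linarith, by linarith, by linarith⟩
    · ext <;> simp <;>
        first | linear_combination (F 2).1 * hsum - e1 | linear_combination (F 2).2 * hsum - e2
  · exact absurd ⟨by linarith, by linarith, by linarith, by linarith⟩ hc'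

theorem volume_line_eq_zero {a c : ℝ × ℝ} (h : a ≠ c) : volume {x | orient a c x = 0} = 0 := by
  have hne : ∃ y, cross (c - a) y ≠ 0 := by
    by_contra! hy
    apply h
    have h1 := hy (1, 0)
    have h2 := hy (0, 1)
    simp [cross] at h1 h2
    ext <;> linarith
  let f : ℝ × ℝ →ₗ[ℝ] ℝ := (c - a).1 • LinearMap.snd ℝ ℝ ℝ - (c - a).2 • LinearMap.fst ℝ ℝ ℝ
  have hf : ∀ x, f x = cross (c - a) x := fun x => by simp [f, cross]
  have hset : {x | orient a c x = 0} = (fun x => -a + x) ⁻¹' (LinearMap.ker f : Set (ℝ × ℝ)) := by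
    ext x
    simp only [Set.mem_ofPred_eq, Set.mem_preimage, SetLike.mem_coe, LinearMap.mem_ker, hf,
      orient_eq_cross]
    rw [show -a + x = x - a by abel]
  rw [hset, measure_preimage_add]
  refine Measure.addHaar_submodule _ _ fun htop => ?_
  obtain ⟨y, hy⟩ := hne
  apply hy
  rw [← hf, ← LinearMap.mem_ker, htop]
  trivial

theorem convex_halfplane (u : ℝ × ℝ) (r : ℝ) : Convex ℝ {x : ℝ × ℝ | r ≤ cross u x} := by
  intro x hx y hy s t hs ht hst
  simp only [Set.mem_ofPred_eq] at *
  have : cross u (s • x + t • y) = s * cross u x + t * cross u y := by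
    simp [cross]; ring
  rw [this]
  calc r = s * r + t * r := by rw [← add_mul, hst, one_mul]
    _ ≤ _ := by gcongr

/-- The area of a convex quadrilateral, from below. -/
theorem le_area_of_isQuadrilateral {F : Fin 4 → ℝ × ℝ} (hF : IsQuadrilateral F) :
    ENNReal.ofReal (cross (F 2 - F 0) (F 3 - F 1)) * unitTriangleArea ≤ area F := by
  by_cases h : F 0 = F 2
  · simp [h, cross]
  have h1 := hF 0 1 2 (by decide) (by decide)
  have h2 := hF 0 2 3 (by decide) (by decide)
  have hsum : cross (F 2 - F 0) (F 3 - F 1) =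
      |orient (F 0) (F 1) (F 2)| + |orient (F 0) (F 2) (F 3)| := by
    rw [abs_of_nonneg h1, abs_of_nonneg h2]
    simp only [orient, cross, Prod.fst_sub, Prod.snd_sub]; ring
  rw [hsum, ENNReal.ofReal_add (abs_nonneg _) (abs_nonneg _), add_mul, ← volume_triangle,
    ← volume_triangle]
  have hm : MeasurableSet (convexHull ℝ {F 0, F 2, F 3}) := by
    apply IsClosed.measurableSet
    exact (Set.Finite.isClosed_convexHull ℝ (by simp))
  rw [← measure_union₀' (μ := volume)]
  · refine measure_mono (Set.union_subset (convexHull_mono ?_) (convexHull_mono ?_))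
    · rintro x (rfl | rfl | rfl) <;> exact ⟨_, rfl⟩
    · rintro x (rfl | rfl | rfl) <;> exact ⟨_, rfl⟩
  · apply IsClosed.nullMeasurableSet
    exact (Set.Finite.isClosed_convexHull ℝ (by simp))
  -- The two triangles lie on opposite sides of the diagonal and overlap only on its line.
  · refine measure_mono_null ?_ (volume_line_eq_zero h)
    rintro x ⟨hx1, hx2⟩
    have k1 : x ∈ {x | -cross (F 2 - F 0) (F 0) ≤ cross (F 0 - F 2) x} := by
      refine convexHull_min ?_ (convex_halfplane _ _) hx1
      simp only [orient] at h1
      rintro y (rfl | rfl | rfl) <;> simp only [Set.mem_ofPred_eq, cross, Prod.fst_sub, Prod.snd_sub] <;>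
        linarith
    have k2 : x ∈ {x | cross (F 2 - F 0) (F 0) ≤ cross (F 2 - F 0) x} := by
      refine convexHull_min ?_ (convex_halfplane _ _) hx2
      simp only [orient] at h2
      rintro y (rfl | rfl | rfl) <;> simp only [Set.mem_ofPred_eq, cross, Prod.fst_sub, Prod.snd_sub] <;>
        linarith
    simp only [Set.mem_ofPred_eq, cross, orient, Prod.fst_sub, Prod.snd_sub] at k1 k2 ⊢
    linarith

end ConvexPolygon

/-! ### Merging the edge directions of the two chains of a convex polygon -/

namespace ConvexPolygon

/-! ### Algebra of the cross product and angular order in a half-plane. -/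

theorem cross_neg_left (u v : ℝ × ℝ) : cross (-u) v = -cross u v := by simp [cross]; ring

theorem cross_neg_right (u v : ℝ × ℝ) : cross u (-v) = -cross u v := by simp [cross]; ring

theorem cross_add_left (u v w : ℝ × ℝ) : cross (u + v) w = cross u w + cross v w := by
  simp [cross]; ring

theorem cross_add_right (u v w : ℝ × ℝ) : cross u (v + w) = cross u v + cross u w := by
  simp [cross]; ring

theorem cross_sub_left (u v w : ℝ × ℝ) : cross (u - v) w = cross u w - cross v w := by
  simp [cross]; ring

theorem cross_sub_right (u v w : ℝ × ℝ) : cross u (v - w) = cross u v - cross u w := by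
  simp [cross]; ring

theorem cross_smul_right (r : ℝ) (u v : ℝ × ℝ) : cross u (r • v) = r * cross u v := by
  simp [cross]; ring

theorem cross_self (u : ℝ × ℝ) : cross u u = 0 := by simp [cross]; ring

theorem cross_comm (u v : ℝ × ℝ) : cross u v = -cross v u := by simp [cross]; ring

/-- The three-term Plücker relation. -/
theorem cross_mul_cross (a b c d : ℝ × ℝ) :
    cross a c * cross b d = cross a b * cross c d + cross a d * cross b c := by
  simp only [cross]; ring

/-- Sortedness by angle is transitive in a half-plane. -/
theorem cross_nonneg_trans {z u v w : ℝ × ℝ} (hu : 0 ≤ cross z u) (hv : 0 ≤ cross z v)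
    (hw : 0 ≤ cross z w) (h : 0 < cross z u ∨ 0 < cross z v) (huv : 0 ≤ cross u v)
    (hvw : 0 < cross v w) : 0 ≤ cross u w := by
  have key := cross_mul_cross z u v w
  have h1 := mul_nonneg hw huv
  rcases hv.lt_or_eq with h2 | h2
  · have : 0 ≤ cross z v * cross u w := by
      rw [key]; positivity
    exact nonneg_of_mul_nonneg_right this h2
  -- With v on the boundary of the half-plane, u is strictly inside, and the Plücker relation would
  -- equate 0 with a positive number.
  · rcases h with h3 | h3
    · have := mul_pos h3 hvw
      rw [← h2] at key
      linarith
    · linarith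

theorem cross_pos_trans {z u v w : ℝ × ℝ} (hu : 0 ≤ cross z u) (hv : 0 < cross z v)
    (hw : 0 < cross z w) (huv : 0 < cross u v) (hvw : 0 ≤ cross v w) : 0 < cross u w := by
  have key := cross_mul_cross z u v w
  have h1 := mul_pos hw huv
  have h2 := mul_nonneg hu hvw
  exact pos_of_mul_pos_right (a := cross z v) (by rw [key]; positivity) hv.le

/-- The vertices of a convex polygon in counterclockwise order, repeated with period `n`. -/
structure ConvexCycle (n : ℕ) (P : ℕ → ℝ × ℝ) : Prop where
  three_le : 3 ≤ n
  periodic : Function.Periodic P n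
  orient_pos : ∀ i j k, i < j → j < k → k < n → 0 < orient (P i) (P j) (P k)

/-- The edge leaving vertex number `i`. -/
def edge (P : ℕ → ℝ × ℝ) (i : ℕ) : ℝ × ℝ := P (i + 1) - P i

/-- A vector such that the vertex number `0` is the only lowest one in its normal direction. -/
def baseDir (n : ℕ) (P : ℕ → ℝ × ℝ) : ℝ × ℝ := P 1 - P (n - 1)

/-! ### Convexity of the vertex cycle. -/

namespace ConvexCycle

variable {n : ℕ} {P : ℕ → ℝ × ℝ}

theorem edge_periodic (h : ConvexCycle n P) : Function.Periodic (edge P) n := by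
  intro i
  have h1 := h.periodic i
  have h2 := h.periodic (i + 1)
  simp only [edge]
  rw [h1, show i + n + 1 = i + 1 + n by ring, h2]

/-- Up to a cyclic rotation this is an ordered triple of vertices; the edge from n - 1 back to 0 is
handled separately. -/
theorem cross_edge_vertex_nonneg (h : ConvexCycle n P) (i j : ℕ) :
    0 ≤ cross (edge P i) (P j - P i) := by
  have hn := h.three_le
  rw [← h.edge_periodic.map_mod_nat i, ← h.periodic.map_mod_nat i, ← h.periodic.map_mod_nat j]
  have hi : i % n < n := Nat.mod_lt _ (by omega)
  have hj : j % n < n := Nat.mod_lt _ (by omega)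
  generalize i % n = i at *
  generalize j % n = j at *
  rcases Nat.lt_or_ge (i + 1) n with h1 | h1
  · rcases lt_trichotomy j i with h2 | rfl | h2
    · have := h.orient_pos j i (i + 1) h2 (by omega) h1
      simp only [orient, cross, edge, Prod.fst_sub, Prod.snd_sub] at *
      linarith
    · simp [cross]
    · rcases Nat.eq_or_lt_of_le (Nat.succ_le_of_lt h2) with h3 | h3
      · rw [← h3, edge, Nat.succ_eq_add_one, cross_self]
      · have := h.orient_pos i (i + 1) j (by omega) h3 hj
        rw [orient_eq_cross] at this
        exact this.le
  · obtain rfl : n = i + 1 := by omega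
    have hp : P (i + 1) = P 0 := by simpa using h.periodic 0
    rw [edge, hp]
    rcases Nat.eq_zero_or_pos j with rfl | h2
    · simp [cross_self]
    · rcases Nat.lt_or_ge j i with h3 | h3
      · have := h.orient_pos 0 j i h2 h3 (by omega)
        simp only [orient, cross, Prod.fst_sub, Prod.snd_sub] at *
        linarith
      · obtain rfl : j = i := by omega
        simp [cross]

theorem cross_edge_succ_pos (h : ConvexCycle n P) (i : ℕ) :
    0 < cross (edge P i) (edge P (i + 1)) := by
  have hn := h.three_le
  have e1 : edge P (i + 1) = edge P (i % n + 1) := by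
    rw [← h.edge_periodic.map_mod_nat (i + 1), ← h.edge_periodic.map_mod_nat (i % n + 1)]
    simp
  rw [e1, ← h.edge_periodic.map_mod_nat i]
  have hi : i % n < n := Nat.mod_lt _ (by omega)
  generalize i % n = i at *
  clear e1
  rcases Nat.lt_or_ge (i + 2) n with h1 | h1
  · have := h.orient_pos i (i + 1) (i + 2) (by omega) (by omega) h1
    simp only [orient, cross, edge, Prod.fst_sub, Prod.snd_sub] at *
    linarith
  · have h0 : P n = P 0 := by simpa using h.periodic 0
    have h1' : P (n + 1) = P 1 := by simpa [add_comm] using h.periodic 1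
    rcases Nat.lt_or_ge (i + 1) n with h2 | h2
    · obtain rfl : n = i + 2 := by omega
      have := h.orient_pos 0 i (i + 1) (by omega) (by omega) (by omega)
      simp only [edge]
      rw [show i + 1 + 1 = i + 2 by ring, h0]
      simp only [orient, cross, Prod.fst_sub, Prod.snd_sub] at *
      linarith
    · obtain rfl : n = i + 1 := by omega
      have := h.orient_pos 0 1 i (by omega) (by omega) (by omega)
      simp only [edge]
      rw [h0, h1']
      simp only [orient, cross, Prod.fst_sub, Prod.snd_sub] at *
      linarith

/-- A vertex that is locally extreme in some direction is globally extreme. -/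
theorem cross_vertex_nonneg_of_local (h : ConvexCycle n P) {w : ℝ × ℝ} {i : ℕ}
    (h1 : cross w (edge P i) ≤ 0) (h2 : 0 ≤ cross w (edge P (i + 1))) (j : ℕ) :
    0 ≤ cross w (P j - P (i + 1)) := by
  have k1 := h.cross_edge_vertex_nonneg i j
  have k2 := h.cross_edge_vertex_nonneg (i + 1) j
  have k3 := h.cross_edge_succ_pos i
  -- P j - P (i + 1) lies in the cone spanned by -edge i and edge (i + 1), on both of which cross w
  -- is nonnegative.
  have key := cross_mul_cross w (edge P i) (P j - P (i + 1)) (edge P (i + 1))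
  have k4 : cross (edge P i) (P j - P (i + 1)) = cross (edge P i) (P j - P i) := by
    rw [show P j - P (i + 1) = (P j - P i) - edge P i by simp [edge], cross_sub_right, cross_self,
      sub_zero]
  rw [k4, cross_comm (P j - P (i + 1))] at key
  have := mul_nonneg (neg_nonneg.2 h1) k2
  have := mul_nonneg h2 k1
  refine nonneg_of_mul_nonneg_left (b := cross (edge P i) (edge P (i + 1))) ?_ k3
  linarith

theorem vertex_n (h : ConvexCycle n P) : P n = P 0 := by simpa using h.periodic 0

theorem edge_n (h : ConvexCycle n P) : edge P n = edge P 0 := by simpa using h.edge_periodic 0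

theorem baseDir_eq (h : ConvexCycle n P) : baseDir n P = edge P 0 + edge P (n - 1) := by
  have := h.three_le
  rw [edge, edge, Nat.sub_add_cancel (by omega), h.vertex_n, baseDir]
  simp

theorem cross_edge_last_pos (h : ConvexCycle n P) : 0 < cross (edge P (n - 1)) (edge P 0) := by
  have := h.cross_edge_succ_pos (n - 1)
  have hn := h.three_le
  rwa [Nat.sub_add_cancel (by omega), h.edge_n] at this

theorem baseDir_first (h : ConvexCycle n P) : 0 < cross (baseDir n P) (edge P 0) := by
  rw [h.baseDir_eq, cross_add_left, cross_self, zero_add]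
  exact h.cross_edge_last_pos

theorem baseDir_last (h : ConvexCycle n P) : cross (baseDir n P) (edge P (n - 1)) < 0 := by
  rw [h.baseDir_eq, cross_add_left, cross_self, add_zero, cross_comm]
  linarith [h.cross_edge_last_pos]

/-- The height of P j above P 0 is the sum of the orientations of the triangles 0, 1, j and 0, j, n
- 1; neither is negative, and as n ≥ 3 they are not both flat. -/
theorem baseDir_vertex_pos (h : ConvexCycle n P) {j : ℕ} (hj : 0 < j) (hj' : j < n) :
    0 < cross (baseDir n P) (P j - P 0) := by
  have hn := h.three_le
  have e : cross (baseDir n P) (P j - P 0) =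
      orient (P 0) (P 1) (P j) + orient (P 0) (P j) (P (n - 1)) := by
    simp only [orient, cross, baseDir, Prod.fst_sub, Prod.snd_sub]; ring
  rw [e]
  rcases Nat.eq_or_lt_of_le (Nat.succ_le_of_lt hj) with h1 | h1
  · have := h.orient_pos 0 1 (n - 1) (by omega) (by omega) (by omega)
    simp only [Nat.succ_eq_add_one, zero_add] at h1
    rw [← h1]
    have : orient (P 0) (P 1) (P 1) = 0 := by simp [orient]
    linarith
  · have := h.orient_pos 0 1 j (by omega) h1 hj'
    rcases Nat.lt_or_ge j (n - 1) with h2 | h2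
    · have := h.orient_pos 0 j (n - 1) hj h2 (by omega)
      linarith
    · obtain rfl : j = n - 1 := by omega
      have : orient (P 0) (P (n - 1)) (P (n - 1)) = 0 := by simp [orient]
      linarith

end ConvexCycle

/-- The edges `0, …, m - 1` ascend from vertex `0`, and edge `m` does not. -/
structure IsSplit (n : ℕ) (P : ℕ → ℝ × ℝ) (m : ℕ) : Prop where
  pos : 0 < m
  lt : m < n
  ascending : ∀ i < m, 0 < cross (baseDir n P) (edge P i)
  not_ascending : cross (baseDir n P) (edge P m) ≤ 0

/-! ### Angular order of the edges on each chain. -/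

namespace IsSplit

variable {n m : ℕ} {P : ℕ → ℝ × ℝ}

/-- If edge i does not ascend and edge i + 1 does not descend, vertex i + 1 is a local, hence
global, lowest point, yet it lies strictly above vertex 0. -/
theorem descending (hm : IsSplit n P m) (h : ConvexCycle n P) {i : ℕ} (hi : m < i) (hi' : i < n) :
    cross (baseDir n P) (edge P i) < 0 := by
  have step : ∀ i, m ≤ i → i + 1 < n → cross (baseDir n P) (edge P i) ≤ 0 →
      cross (baseDir n P) (edge P (i + 1)) < 0 := by
    intro i h1 h2 h3
    have hpos := hm.pos
    have k1 := h.cross_edge_vertex_nonneg i 0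
    have k2 := h.cross_edge_vertex_nonneg (i + 1) 0
    have k3 := h.cross_edge_succ_pos i
    have k4 := h.baseDir_vertex_pos (j := i + 1) (by omega) h2
    have key := cross_mul_cross (baseDir n P) (edge P i) (edge P (i + 1)) (P 0 - P (i + 1))
    have k5 : cross (edge P i) (P 0 - P (i + 1)) = cross (edge P i) (P 0 - P i) := by
      rw [show P 0 - P (i + 1) = (P 0 - P i) - edge P i by simp [edge], cross_sub_right,
        cross_self, sub_zero]
    have k6 : cross (baseDir n P) (P 0 - P (i + 1)) = - cross (baseDir n P) (P (i + 1) - P 0) := by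
      rw [← cross_neg_right, neg_sub]
    rw [k5, k6] at key
    by_contra! hc
    have := mul_nonneg hc k1
    have := mul_nonneg (neg_nonneg.2 h3) k2
    have := mul_pos k4 k3
    linarith
  induction i, hi using Nat.le_induction with
  | base => exact step m le_rfl hi' hm.not_ascending
  | succ i hi ih =>
    exact step i (by omega) hi' (ih (by omega)).le

theorem cross_right_pos (hm : IsSplit n P m) (h : ConvexCycle n P) {i j : ℕ} (hij : i < j)
    (hj : j < m) : 0 < cross (edge P i) (edge P j) := by
  induction j, hij using Nat.le_induction with
  | base => exact h.cross_edge_succ_pos i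
  | succ j hij ih =>
    exact cross_pos_trans (hm.ascending i (by omega)).le (hm.ascending j (by omega))
      (hm.ascending _ hj) (ih (by omega)) (h.cross_edge_succ_pos j).le

theorem not_ascending_of_le (hm : IsSplit n P m) (h : ConvexCycle n P) {i : ℕ} (hi : m ≤ i)
    (hi' : i < n) : cross (baseDir n P) (edge P i) ≤ 0 := by
  rcases hi.eq_or_lt with rfl | hi
  · exact hm.not_ascending
  · exact (hm.descending h hi hi').le

theorem cross_left_pos (hm : IsSplit n P m) (h : ConvexCycle n P) {i j : ℕ} (hi : m ≤ i)
    (hij : i < j) (hj : j < n) : 0 < cross (edge P i) (edge P j) := by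
  induction j, hij using Nat.le_induction with
  | base => exact h.cross_edge_succ_pos i
  | succ j hij ih =>
    have h1 := hm.not_ascending_of_le h hi (by omega)
    have h2 := hm.descending h (i := j) (by omega) (by omega)
    have h3 := hm.descending h (i := j + 1) (by omega) (by omega)
    have := cross_pos_trans (z := baseDir n P) (u := -edge P i) (v := -edge P j)
      (w := -edge P (j + 1)) (by rw [cross_neg_right]; linarith) (by rw [cross_neg_right]; linarith)
      (by rw [cross_neg_right]; linarith)
      (by rw [cross_neg_right, cross_neg_left, neg_neg]; exact ih (by omega))
      (by rw [cross_neg_right, cross_neg_left, neg_neg]; exact (h.cross_edge_succ_pos j).le)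
    rwa [cross_neg_right, cross_neg_left, neg_neg] at this

end IsSplit

open Classical in
/-- One step of the merge: the state is a pair of vertex numbers on the right and left chains. -/
noncomputable def mergeStep (n : ℕ) (P : ℕ → ℝ × ℝ) (m : ℕ) (s : ℕ × ℕ) : ℕ × ℕ :=
  if s.1 < m ∧ (s.2 < n → 0 ≤ cross (edge P s.1) (-edge P s.2)) then (s.1 + 1, s.2)
  else (s.1, s.2 + 1)

/-- The state of the merge after `t` steps. -/
noncomputable def mergeState (n : ℕ) (P : ℕ → ℝ × ℝ) (m t : ℕ) : ℕ × ℕ :=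
  (mergeStep n P m)^[t] (0, m)

open Classical in
/-- The edge direction selected in step `t` of the merge. -/
noncomputable def mergeDir (n : ℕ) (P : ℕ → ℝ × ℝ) (m t : ℕ) : ℝ × ℝ :=
  let s := mergeState n P m t
  if s.1 < m ∧ (s.2 < n → 0 ≤ cross (edge P s.1) (-edge P s.2)) then edge P s.1
  else -edge P s.2

/-! ### Correctness of the merge. -/

section Merge

variable {n m : ℕ} {P : ℕ → ℝ × ℝ}

theorem mergeState_succ (t : ℕ) :
    mergeState n P m (t + 1) = mergeStep n P m (mergeState n P m t) := by
  rw [mergeState, Function.iterate_succ_apply']; rfl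

/-- The two possible outcomes of a step of the merge. -/
theorem merge_cases (n : ℕ) (P : ℕ → ℝ × ℝ) (m t : ℕ) {c a : ℕ}
    (hs : mergeState n P m t = (c, a)) :
    (c < m ∧ (a < n → cross (edge P c) (edge P a) ≤ 0) ∧
      mergeState n P m (t + 1) = (c + 1, a) ∧ mergeDir n P m t = edge P c) ∨
    ((c < m → a < n ∧ 0 < cross (edge P c) (edge P a)) ∧
      mergeState n P m (t + 1) = (c, a + 1) ∧ mergeDir n P m t = -edge P a) := by
  rw [mergeState_succ, hs, mergeStep, mergeDir, hs]
  dsimp only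
  split_ifs with h
  · left
    refine ⟨h.1, fun ha => ?_, rfl, rfl⟩
    have := h.2 ha
    rw [cross_neg_right] at this
    linarith
  · right
    refine ⟨fun hc => ?_, rfl, rfl⟩
    by_contra hcon
    refine h ⟨hc, fun ha => ?_⟩
    rw [cross_neg_right]
    by_contra hneg
    exact hcon ⟨ha, by linarith⟩

/-- One of the two contact points moves along its edge; the left one enters the difference with a
minus sign, hence the negated edge. -/
theorem mergeDir_eq (t : ℕ) : mergeDir n P m t =
    (P (mergeState n P m (t + 1)).1 - P (mergeState n P m (t + 1)).2) -
      (P (mergeState n P m t).1 - P (mergeState n P m t).2) := by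
  obtain ⟨c, a, hs⟩ : ∃ c a, mergeState n P m t = (c, a) := ⟨_, _, rfl⟩
  rcases merge_cases n P m t hs with ⟨-, -, h1, h2⟩ | ⟨-, h1, h2⟩ <;>
  · rw [h1, h2, hs]; simp [edge]

theorem mergeState_mono : Monotone (mergeState n P m) := by
  refine monotone_nat_of_le_succ fun t => ?_
  obtain ⟨c, a, hs⟩ : ∃ c a, mergeState n P m t = (c, a) := ⟨_, _, rfl⟩
  rcases merge_cases n P m t hs with ⟨-, -, h1, -⟩ | ⟨-, h1, -⟩ <;>
  · rw [h1, hs]; exact ⟨by simp, by simp⟩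

/-- The invariant of the merge. -/
structure MergeInv (n : ℕ) (P : ℕ → ℝ × ℝ) (m t c a : ℕ) : Prop where
  sum : c + a = t + m
  right_le : c ≤ m
  le_left : m ≤ a
  left_le : a ≤ n
  prev_left : c < m → m < a → cross (edge P (a - 1)) (edge P c) ≤ 0
  prev_right : 0 < c → a < n → cross (edge P (c - 1)) (edge P a) ≤ 0

/-- The usual invariant of merging two sorted lists: the last element taken from either list
precedes the next one of the other. -/
theorem mergeInv (h : ConvexCycle n P) (hm : IsSplit n P m) {t : ℕ} (ht : t ≤ n) :
    MergeInv n P m t (mergeState n P m t).1 (mergeState n P m t).2 := by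
  induction t with
  | zero =>
    refine ⟨by simp [mergeState], by simp [mergeState], by simp [mergeState],
      by simpa [mergeState] using hm.lt.le, by simp [mergeState], by simp [mergeState]⟩
  | succ t ih =>
    have I := ih (by omega)
    obtain ⟨I1, I2, I3, I4, I5, I6⟩ := I
    obtain ⟨c, a, hs⟩ : ∃ c a, mergeState n P m t = (c, a) := ⟨_, _, rfl⟩
    rw [hs] at I1 I2 I3 I4 I5 I6
    dsimp only at I1 I2 I3 I4 I5 I6
    rcases merge_cases n P m t hs with ⟨h1, h2, h3, -⟩ | ⟨h1, h3, -⟩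
    · rw [h3]
      refine ⟨by simp; omega, h1, I3, I4, fun h4 h5 => ?_, fun _ h5 => ?_⟩
      · dsimp only at *
        have z1 := hm.not_ascending_of_le h (i := a - 1) (by omega) (by omega)
        have := cross_nonneg_trans (z := baseDir n P) (u := -edge P (a - 1)) (v := edge P c)
          (w := edge P (c + 1)) (by rw [cross_neg_right]; linarith) (hm.ascending c h1).le
          (hm.ascending _ h4).le (Or.inr (hm.ascending c h1))
          (by rw [cross_neg_left]; linarith [I5 h1 h5]) (h.cross_edge_succ_pos c)
        rw [cross_neg_left] at this
        linarith
      · simpa using h2 h5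
    · have ha : a < n := by
        rcases I2.lt_or_eq with h4 | h4
        · exact (h1 h4).1
        · omega
      rw [h3]
      refine ⟨by simp; omega, I2, by simp; omega, by simp; omega, fun h4 _ => ?_, fun h4 h5 => ?_⟩
      · dsimp only at *
        have := (h1 h4).2
        rw [Nat.add_sub_cancel, cross_comm]
        linarith
      · dsimp only at *
        have z1 := hm.not_ascending_of_le h I3 ha
        have z2 := hm.not_ascending_of_le h (i := a + 1) (by omega) h5
        have z3 := hm.ascending (c - 1) (by omega)
        have := cross_nonneg_trans (z := baseDir n P) (u := edge P (c - 1)) (v := -edge P a)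
          (w := -edge P (a + 1)) z3.le (by rw [cross_neg_right]; linarith)
          (by rw [cross_neg_right]; linarith) (Or.inl z3)
          (by rw [cross_neg_right]; linarith [I6 h4 ha])
          (by rw [cross_neg_right, cross_neg_left, neg_neg]; exact h.cross_edge_succ_pos a)
        rw [cross_neg_right] at this
        linarith

theorem mergeState_n (h : ConvexCycle n P) (hm : IsSplit n P m) :
    mergeState n P m n = (m, n) := by
  have := mergeInv h hm le_rfl
  have h1 := this.sum
  have h2 := this.right_le
  have h3 := this.left_le
  ext <;> simp <;> omega

/-- Once the right chain is used up, c + a = t + m with t < n still leaves an edge on the left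
chain. -/
theorem left_lt_of_merge (h : ConvexCycle n P) (hm : IsSplit n P m) {t : ℕ} (ht : t < n)
    (h1 : (mergeState n P m t).1 < m → (mergeState n P m t).2 < n) :
    (mergeState n P m t).2 < n := by
  have I := mergeInv h hm ht.le
  rcases I.right_le.lt_or_eq with h4 | h4
  · exact h1 h4
  · have := I.sum; omega

/-- At each contact vertex the selected direction lies, in angle, between the two adjacent edges,
the left ones being negated. So the vertex is locally extreme, and `cross_vertex_nonneg_of_local`
makes it globally extreme. For the contact whose own edge is selected, `cross_edge_vertex_nonneg`
suffices. -/
theorem merge_support (h : ConvexCycle n P) (hm : IsSplit n P m) {t : ℕ} (ht : t < n) (j : ℕ) :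
    0 ≤ cross (mergeDir n P m t) (P j - P (mergeState n P m t).1) ∧
      cross (mergeDir n P m t) (P j - P (mergeState n P m t).2) ≤ 0 := by
  have I := mergeInv h hm ht.le
  have hl := left_lt_of_merge h hm ht
  obtain ⟨I1, I2, I3, I4, I5, I6⟩ := I
  obtain ⟨c, a, hs⟩ : ∃ c a, mergeState n P m t = (c, a) := ⟨_, _, rfl⟩
  rw [hs] at I1 I2 I3 I4 I5 I6 hl ⊢
  dsimp only at I1 I2 I3 I4 I5 I6 hl ⊢
  have hm0 := hm.pos
  have hmn := hm.lt
  rcases merge_cases n P m t hs with ⟨h1, h2, -, h3⟩ | ⟨h1, -, h3⟩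
  · rw [h3]
    refine ⟨h.cross_edge_vertex_nonneg c j, ?_⟩
    have e : a = (a - 1) + 1 := by omega
    have := h.cross_vertex_nonneg_of_local (w := -edge P c) (i := a - 1) ?_ ?_ j
    · rw [← e, cross_neg_left] at this
      linarith
    · rw [cross_neg_left]
      rcases I3.lt_or_eq with h4 | h4
      · have := I5 h1 h4
        rw [cross_comm] at this
        linarith
      · rcases (Nat.le_sub_one_of_lt h1).lt_or_eq with h5 | h5
        · have := hm.cross_right_pos h (i := c) (j := a - 1) (by omega) (by omega)
          linarith
        · rw [← h4, h5, cross_self]; simp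
    · rw [← e, cross_neg_left]
      rcases I4.lt_or_eq with h4 | h4
      · linarith [h2 h4]
      · rw [h4, h.edge_n]
        rcases Nat.eq_zero_or_pos c with h5 | h5
        · rw [h5, cross_self]; simp
        · have := hm.cross_right_pos h h5 h1
          rw [cross_comm] at this
          linarith
  · have ha := hl fun h4 => (h1 h4).1
    rw [h3]
    constructor
    · have hnext : 0 ≤ cross (-edge P a) (edge P c) := by
        rw [cross_neg_left]
        rcases I2.lt_or_eq with h4 | h4
        · have := (h1 h4).2
          rw [cross_comm] at this
          linarith
        · rw [h4]
          rcases I3.lt_or_eq with h5 | h5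
          · have := hm.cross_left_pos h le_rfl h5 ha
            rw [cross_comm] at this
            linarith
          · rw [h5, cross_self]; simp
      rcases Nat.eq_zero_or_pos c with h4 | h4
      · subst h4
        have e : n = (n - 1) + 1 := by omega
        have := h.cross_vertex_nonneg_of_local (w := -edge P a) (i := n - 1) ?_ ?_ j
        · rwa [← e, h.vertex_n] at this
        · rw [cross_neg_left]
          rcases (Nat.le_sub_one_of_lt ha).lt_or_eq with h5 | h5
          · have := hm.cross_left_pos h I3 h5 (by omega)
            linarith
          · rw [h5, cross_self]; simp
        · rwa [← e, h.edge_n]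
      · have e : c = (c - 1) + 1 := by omega
        have := h.cross_vertex_nonneg_of_local (w := -edge P a) (i := c - 1) ?_ ?_ j
        · rwa [← e] at this
        · have := I6 h4 ha
          rw [cross_neg_left]
          rw [cross_comm] at this
          linarith
        · rwa [← e]
    · rw [cross_neg_left]
      linarith [h.cross_edge_vertex_nonneg a j]

/-- The polygon is not flat: the vertex two steps after the start of the selected edge is strictly
off its line, and it lies within the strip. -/
theorem merge_strict (h : ConvexCycle n P) (hm : IsSplit n P m) {t : ℕ} (ht : t < n) :
    0 < cross (P (mergeState n P m t).1 - P (mergeState n P m t).2) (mergeDir n P m t) := by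
  have S := merge_support h hm ht
  have key : ∀ i, 0 < cross (edge P i) (P (i + 2) - P i) := by
    intro i
    have := h.cross_edge_succ_pos i
    have e : P (i + 2) - P i = edge P i + edge P (i + 1) := by simp [edge]
    rwa [e, cross_add_right, cross_self, zero_add]
  obtain ⟨c, a, hs⟩ : ∃ c a, mergeState n P m t = (c, a) := ⟨_, _, rfl⟩
  rw [hs] at S ⊢
  dsimp only at S ⊢
  rw [cross_comm]
  rcases merge_cases n P m t hs with ⟨-, -, -, h3⟩ | ⟨-, -, h3⟩
  · have h4 := (S (c + 2)).2
    have h5 := key c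
    rw [h3] at h4 ⊢
    simp only [cross_sub_right] at *
    linarith
  · have h4 := (S (a + 2)).1
    have h5 := key a
    rw [h3] at h4 ⊢
    simp only [cross_sub_right, cross_neg_left] at *
    linarith

/-- If both directions come from the same chain, they are sorted already. Otherwise the comparison
made in step j is continued along the chain of the later direction by transitivity in the
half-plane. -/
theorem merge_sorted (h : ConvexCycle n P) (hm : IsSplit n P m) {j i : ℕ} (hji : j ≤ i)
    (hi : i < n) : 0 ≤ cross (mergeDir n P m j) (mergeDir n P m i) := by
  rcases hji.eq_or_lt with rfl | hji
  · rw [cross_self]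
  have Ij := mergeInv h hm (hji.trans hi).le
  have Ii := mergeInv h hm hi.le
  have hlj := left_lt_of_merge h hm (hji.trans hi)
  have hli := left_lt_of_merge h hm hi
  have mono := mergeState_mono (n := n) (P := P) (m := m) (Nat.succ_le_of_lt hji)
  obtain ⟨c, a, hs⟩ : ∃ c a, mergeState n P m j = (c, a) := ⟨_, _, rfl⟩
  obtain ⟨c', a', hs'⟩ : ∃ c a, mergeState n P m i = (c, a) := ⟨_, _, rfl⟩
  have Ijl := Ij.le_left
  have Iil := Ii.le_left
  rw [hs] at Ijl hlj
  rw [hs'] at Iil hli mono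
  dsimp only at *
  have zl : ∀ k, m ≤ k → k < n → 0 ≤ cross (baseDir n P) (-edge P k) := by
    intro k h1 h2
    rw [cross_neg_right]
    linarith [hm.not_ascending_of_le h h1 h2]
  rcases merge_cases n P m j hs with ⟨h1, h2, h3, h4⟩ | ⟨h1, h3, h4⟩ <;>
  rcases merge_cases n P m i hs' with ⟨h1', h2', -, h4'⟩ | ⟨h1', -, h4'⟩ <;>
  rw [h4, h4'] <;> rw [Nat.succ_eq_add_one, h3] at mono <;> obtain ⟨m1, m2⟩ := mono <;>
  dsimp only at m1 m2
  · exact (hm.cross_right_pos h m1 h1').le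
  · have ha' := hli fun h5 => (h1' h5).1
    have h5 := h2 (by omega)
    have h6 : 0 ≤ cross (edge P c) (-edge P a) := by rw [cross_neg_right]; linarith
    rcases m2.eq_or_lt with rfl | h7
    · exact h6
    · refine cross_nonneg_trans (z := baseDir n P) (v := -edge P a) (hm.ascending c h1).le
        (zl a Ijl (by omega)) (zl a' Iil ha') (Or.inl (hm.ascending c h1)) h6 ?_
      rw [cross_neg_right, cross_neg_left, neg_neg]
      exact hm.cross_left_pos h Ijl h7 ha'
  · have h5 := h1 (by omega)
    have h6 : 0 ≤ cross (-edge P a) (edge P c) := by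
      rw [cross_neg_left, cross_comm]; linarith [h5.2]
    rcases m1.eq_or_lt with rfl | h7
    · exact h6
    · exact cross_nonneg_trans (z := baseDir n P) (v := edge P c) (zl a Ijl h5.1)
        (hm.ascending c (by omega)).le (hm.ascending c' h1').le
        (Or.inr (hm.ascending c (by omega))) h6 (hm.cross_right_pos h h7 h1')
  · have ha' := hli fun h5 => (h1' h5).1
    rw [cross_neg_right, cross_neg_left, neg_neg]
    exact (hm.cross_left_pos h Ijl m2 ha').le

end Merge

end ConvexPolygon

/-! ### Rotating calipers -/

namespace ConvexPolygon

/-- A full turn of a pair of parallel supporting lines of `S`, in `2 * n` steps: in step `t`, the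
lines have the direction `f t`, the contact point `C t` has `S` on the left, and `A t` has `S` on
the right. -/
structure Calipers (n : ℕ) (S : Set (ℝ × ℝ)) (C A f : ℕ → ℝ × ℝ) : Prop where
  pos : 0 < n
  memC : ∀ t, C t ∈ S
  memA : ∀ t, A t ∈ S
  shiftC : ∀ t, C (t + n) = A t
  shiftA : ∀ t, A (t + n) = C t
  shift_dir : ∀ t, f (t + n) = -f t
  step : ∀ t, C (t + 1) - A (t + 1) = C t - A t + f t
  support_left : ∀ t, ∀ x ∈ S, 0 ≤ cross (f t) (x - C t)
  support_right : ∀ t, ∀ x ∈ S, cross (f t) (x - A t) ≤ 0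
  sorted : ∀ j i, j ≤ i → i ≤ j + n → 0 ≤ cross (f j) (f i)
  width_pos : ∀ t, 0 < cross (C t - A t) (f t)

/-- The sequence that consists of `x 0, …, x (n - 1)` and `y 0, …, y (n - 1)`, alternately. -/
def alternate {α : Type*} (n : ℕ) (x y : ℕ → α) (t : ℕ) : α :=
  if Even (t / n) then x (t % n) else y (t % n)

theorem alternate_of_lt {α : Type*} {n t : ℕ} (x y : ℕ → α) (ht : t < n) :
    alternate n x y t = x t := by
  simp [alternate, Nat.div_eq_of_lt ht, Nat.mod_eq_of_lt ht]

theorem alternate_add {α : Type*} {n : ℕ} (hn : 0 < n) (x y : ℕ → α) (t : ℕ) :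
    alternate n x y (t + n) = alternate n y x t := by
  simp only [alternate, Nat.add_div_right t hn, Nat.add_mod_right, Nat.even_add_one]
  split_ifs <;> rfl

/-- The second half-turn repeats the first with C and A exchanged and f negated, so most properties
need to be checked only for t < n and for invariance under the shift. -/
theorem induction_shift {n : ℕ} (hn : 0 < n) {Φ : ℕ → Prop} (base : ∀ t < n, Φ t)
    (shift : ∀ t, Φ t → Φ (t + n)) (t : ℕ) : Φ t := by
  induction t using Nat.strong_induction_on with
  | _ t ih =>
    rcases Nat.lt_or_ge t n with h | h
    · exact base t h
    · have := shift _ (ih (t - n) (by omega))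
      rwa [Nat.sub_add_cancel h] at this

/-- The contact points of the supporting lines with the polygon on the left. -/
noncomputable def mergeC (n : ℕ) (P : ℕ → ℝ × ℝ) (m : ℕ) : ℕ → ℝ × ℝ :=
  alternate n (fun t => P (mergeState n P m t).1) (fun t => P (mergeState n P m t).2)

/-- The contact points of the supporting lines with the polygon on the right. -/
noncomputable def mergeA (n : ℕ) (P : ℕ → ℝ × ℝ) (m : ℕ) : ℕ → ℝ × ℝ :=
  alternate n (fun t => P (mergeState n P m t).2) (fun t => P (mergeState n P m t).1)

/-- The directions of the supporting lines during the merge. -/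
noncomputable def mergeF (n : ℕ) (P : ℕ → ℝ × ℝ) (m : ℕ) : ℕ → ℝ × ℝ :=
  alternate n (fun t => mergeDir n P m t) (fun t => -mergeDir n P m t)

theorem cross_nonneg_of_convexHull {s : Set (ℝ × ℝ)} {u c : ℝ × ℝ}
    (h : ∀ x ∈ s, 0 ≤ cross u (x - c)) : ∀ x ∈ convexHull ℝ s, 0 ≤ cross u (x - c) := by
  intro x hx
  have : x ∈ {x | cross u c ≤ cross u x} :=
    convexHull_min (fun y hy => by
      have := h y hy
      rw [cross_sub_right] at this
      simpa using this) (convex_halfplane _ _) hx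
  rw [cross_sub_right, sub_nonneg]
  exact this

theorem calipers_merge {n m : ℕ} {P : ℕ → ℝ × ℝ} (h : ConvexCycle n P) (hm : IsSplit n P m) :
    Calipers n (convexHull ℝ (Set.range P)) (mergeC n P m) (mergeA n P m) (mergeF n P m) := by
  have hn : 0 < n := by have := h.three_le; omega
  have sC : ∀ t, mergeC n P m (t + n) = mergeA n P m t := alternate_add hn _ _
  have sA : ∀ t, mergeA n P m (t + n) = mergeC n P m t := alternate_add hn _ _
  have sF : ∀ t, mergeF n P m (t + n) = -mergeF n P m t := by
    intro t
    rw [mergeF, alternate_add hn]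
    simp only [alternate]
    split_ifs <;> simp
  have bC : ∀ t < n, mergeC n P m t = P (mergeState n P m t).1 :=
    fun t ht => alternate_of_lt _ _ ht
  have bA : ∀ t < n, mergeA n P m t = P (mergeState n P m t).2 :=
    fun t ht => alternate_of_lt _ _ ht
  have bF : ∀ t < n, mergeF n P m t = mergeDir n P m t :=
    fun t ht => alternate_of_lt _ _ ht
  have mem : ∀ i, P i ∈ convexHull ℝ (Set.range P) := fun i => subset_convexHull ℝ _ ⟨i, rfl⟩
  have memCA : ∀ t, mergeC n P m t ∈ convexHull ℝ (Set.range P) ∧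
      mergeA n P m t ∈ convexHull ℝ (Set.range P) := by
    refine induction_shift hn (fun t ht => ?_) (fun t ih => ?_)
    · rw [bC t ht, bA t ht]; exact ⟨mem _, mem _⟩
    · rw [sC, sA]; exact ih.symm
  have supp : ∀ t, (∀ x ∈ convexHull ℝ (Set.range P),
      0 ≤ cross (mergeF n P m t) (x - mergeC n P m t)) ∧
      ∀ x ∈ convexHull ℝ (Set.range P), cross (mergeF n P m t) (x - mergeA n P m t) ≤ 0 := by
    refine induction_shift hn (fun t ht => ?_) (fun t ih => ?_)
    · rw [bC t ht, bA t ht, bF t ht]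
      constructor
      · apply cross_nonneg_of_convexHull
        rintro _ ⟨j, rfl⟩
        exact (merge_support h hm ht j).1
      · intro x hx
        have := cross_nonneg_of_convexHull (s := Set.range P) (u := -mergeDir n P m t)
          (c := P (mergeState n P m t).2) ?_ x hx
        · rw [cross_neg_left] at this
          linarith
        · rintro _ ⟨j, rfl⟩
          rw [cross_neg_left]
          linarith [(merge_support h hm ht j).2]
    · rw [sC, sA, sF]
      simp only [cross_neg_left]
      exact ⟨fun x hx => by linarith [ih.2 x hx], fun x hx => by linarith [ih.1 x hx]⟩
  refine ⟨hn, fun t => (memCA t).1, fun t => (memCA t).2, sC, sA, sF, ?_, fun t => (supp t).1,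
    fun t => (supp t).2, ?_, ?_⟩
  · refine induction_shift hn (fun t ht => ?_) (fun t ih => ?_)
    · rw [bC t ht, bA t ht, bF t ht, mergeDir_eq]
      rcases Nat.lt_or_ge (t + 1) n with h1 | h1
      · rw [bC _ h1, bA _ h1]; abel
      -- After n steps the merge arrives at (m, n), which as P n = P 0 is the initial pair (0, m)
      -- with the roles exchanged.
      · obtain rfl : n = t + 1 := by omega
        have e1 := sC 0
        have e2 := sA 0
        rw [zero_add] at e1 e2
        rw [e1, e2, bC 0 hn, bA 0 hn, mergeState_n h hm]
        simp [mergeState, h.vertex_n]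
    · rw [show t + n + 1 = t + 1 + n by ring, sC, sA, sC, sA, sF, ← neg_sub, ih]
      abel
  · have base : ∀ j < n, ∀ i, j ≤ i → i ≤ j + n →
        0 ≤ cross (mergeF n P m j) (mergeF n P m i) := by
      intro j hj i hji hij
      rcases Nat.lt_or_ge i n with h1 | h1
      · rw [bF j hj, bF i h1]
        exact merge_sorted h hm hji h1
      · obtain ⟨i, rfl⟩ := Nat.exists_eq_add_of_le' h1
        rw [sF, cross_neg_right, cross_comm, neg_neg, bF j hj, bF i (by omega)]
        exact merge_sorted h hm (by omega) hj
    intro j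
    refine induction_shift hn (Φ := fun j => ∀ i, j ≤ i → i ≤ j + n →
        0 ≤ cross (mergeF n P m j) (mergeF n P m i)) base (fun j ih i hji hij => ?_) j
    obtain ⟨i, rfl⟩ := Nat.exists_eq_add_of_le' (show n ≤ i by omega)
    rw [sF, sF, cross_neg_left, cross_neg_right, neg_neg]
    exact ih i (by omega) (by omega)
  · refine induction_shift hn (fun t ht => ?_) (fun t ih => ?_)
    · rw [bC t ht, bA t ht, bF t ht]
      exact merge_strict h hm ht
    · rw [sC, sA, sF, ← neg_sub, cross_neg_left, cross_neg_right, neg_neg]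
      exact ih

/-! ### Extremal problems on the difference body. -/

namespace Calipers

variable {n : ℕ} {S : Set (ℝ × ℝ)} {C A f : ℕ → ℝ × ℝ}

theorem shift_sub (h : Calipers n S C A f) (t : ℕ) : C (t + n) - A (t + n) = -(C t - A t) := by
  rw [h.shiftC, h.shiftA, neg_sub]

/-- The line through k_t with direction f t supports the difference body. -/
theorem support (h : Calipers n S C A f) (t : ℕ) {x y : ℝ × ℝ} (hx : x ∈ S) (hy : y ∈ S) :
    0 ≤ cross (f t) (x - y - (C t - A t)) := by
  have h1 := h.support_left t x hx
  have h2 := h.support_right t y hy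
  rw [show x - y - (C t - A t) = (x - C t) - (y - A t) by abel, cross_sub_right]
  linarith

/-- A local maximum of a linear functional on the difference body is a global maximum. -/
theorem le_of_local (h : Calipers n S C A f) {w : ℝ × ℝ} {i : ℕ} (h1 : 0 ≤ cross w (f i))
    (h2 : cross w (f (i + 1)) ≤ 0)
    (h3 : 0 < cross w (f i) ∨ 0 ≤ cross w (C (i + 1) - A (i + 1))) {x y : ℝ × ℝ} (hx : x ∈ S)
    (hy : y ∈ S) : cross w (x - y) ≤ cross w (C (i + 1) - A (i + 1)) := by
  have e := h.step i
  have s1 := h.support i hx hy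
  have s2 := h.support (i + 1) hx hy
  have w1 := h.width_pos i
  have w2 := h.width_pos (i + 1)
  have so := h.sorted i (i + 1) (by omega) (by have := h.pos; omega)
  have w1' : 0 < cross (C (i + 1) - A (i + 1)) (f i) := by
    rw [e, cross_add_left, cross_self, add_zero]; exact w1
  have s1' : 0 ≤ cross (f i) (x - y - (C (i + 1) - A (i + 1))) := by
    rw [e, show x - y - (C i - A i + f i) = (x - y - (C i - A i)) - f i by abel,
      cross_sub_right, cross_self, sub_zero]
    exact s1
  set k := C (i + 1) - A (i + 1)
  set q := x - y - k with hq
  suffices cross w q ≤ 0 by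
    rw [hq, cross_sub_right] at this
    linarith
  -- If the two edges are not parallel, the difference body lies in the cone that they span at k. If
  -- they are parallel, cross w vanishes on both, and the local condition cannot tell a maximum from
  -- a minimum; the sign of cross w k given by `h3` decides.
  rcases so.lt_or_eq with so | so
  · have key := cross_mul_cross w (f i) q (f (i + 1))
    rw [cross_comm q] at key
    have := mul_nonneg h1 s2
    have := mul_nonneg (neg_nonneg.2 h2) s1'
    by_contra! hc
    have := mul_pos hc so
    linarith
  · have key := cross_mul_cross w k (f i) (f (i + 1))
    rw [← so, mul_zero, zero_add] at key
    have hnonpos : cross w (f i) * cross k (f (i + 1)) ≤ 0 := by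
      rw [key]; exact mul_nonpos_of_nonpos_of_nonneg h2 w1'.le
    have hz : cross w (f i) = 0 := by
      by_contra hne
      have := mul_pos (lt_of_le_of_ne h1 (Ne.symm hne)) w2
      linarith
    rw [hz, zero_mul] at key
    have hz2 : cross w (f (i + 1)) = 0 := by
      rcases mul_eq_zero.1 key.symm with h4 | h4
      · exact h4
      · linarith
    have h3' : 0 ≤ cross w k := by
      rcases h3 with h3 | h3
      · linarith
      · exact h3
    have key2 := cross_mul_cross w k q (f (i + 1))
    rw [hz2, zero_mul, add_zero, cross_comm q] at key2
    have := mul_nonneg h3' s2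
    by_contra! hc
    have := mul_pos hc w2
    linarith

/-- Some contact pair is extreme in a given direction. -/
theorem exists_extreme (h : Calipers n S C A f) (r : ℝ × ℝ) :
    ∃ j < n, ∀ x ∈ S, ∀ y ∈ S, |cross r (x - y)| ≤ |cross r (C j - A j)| := by
  obtain ⟨j, hj, hmax⟩ := Finset.exists_max_image (Finset.range n)
    (fun t => |cross r (C t - A t)|) ⟨0, by simpa using h.pos⟩
  rw [Finset.mem_range] at hj
  have per : Function.Periodic (fun t => |cross r (C t - A t)|) n := by
    intro t
    simp only [h.shift_sub, cross_neg_right, abs_neg]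
  have hall : ∀ t, |cross r (C t - A t)| ≤ |cross r (C j - A j)| := by
    intro t
    rw [← per.map_mod_nat t]
    exact hmax _ (Finset.mem_range.2 (Nat.mod_lt _ h.pos))
  -- A shift by n negates the difference, so the maximal absolute value is attained without the
  -- bars. The index has the form i + 1 because `le_of_local` needs the preceding edge.
  obtain ⟨i, hi⟩ : ∃ i, cross r (C (i + 1) - A (i + 1)) = |cross r (C j - A j)| := by
    have hpos := h.pos
    rcases le_total 0 (cross r (C j - A j)) with h1 | h1
    · refine ⟨j + n + n - 1, ?_⟩
      rw [show j + n + n - 1 + 1 = j + n + n by omega, h.shift_sub, h.shift_sub, neg_neg,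
        abs_of_nonneg h1]
    · refine ⟨j + n - 1, ?_⟩
      rw [show j + n - 1 + 1 = j + n by omega, h.shift_sub, cross_neg_right, abs_of_nonpos h1]
  have e1 := h.step i
  have e2 := h.step (i + 1)
  have k1 := (le_abs_self _).trans (hall i)
  have k2 := (le_abs_self _).trans (hall (i + 1 + 1))
  rw [e2, cross_add_right] at k2
  have hi' := hi
  rw [e1, cross_add_right] at hi'
  have key : ∀ x ∈ S, ∀ y ∈ S, cross r (x - y) ≤ |cross r (C j - A j)| := by
    intro x hx y hy
    rw [← hi]
    refine h.le_of_local (by linarith) (by linarith) (Or.inr ?_) hx hy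
    rw [hi]; exact abs_nonneg _
  refine ⟨j, hj, fun x hx y hy => abs_le.2 ⟨?_, key x hx y hy⟩⟩
  have := key y hy x hx
  rw [← neg_sub, cross_neg_right] at this
  linarith

/-- A value that is not exceeded at conjugate contact pairs is not exceeded at all. -/
theorem cross_le_of_conjugate (h : Calipers n S C A f) {M : ℝ}
    (hM : ∀ j < n, ∃ i, 0 < cross (C j - A j) (f i) ∧ cross (C j - A j) (f (i + 1)) ≤ 0 ∧
      cross (C j - A j) (C (i + 1) - A (i + 1)) ≤ M) {a b c d : ℝ × ℝ} (ha : a ∈ S) (hb : b ∈ S)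
    (hc : c ∈ S) (hd : d ∈ S) : cross (c - a) (d - b) ≤ M := by
  -- Bilinearity: c - a is replaced by an extreme k_j for fixed d - b, then d - b by the conjugate
  -- of k_j.
  obtain ⟨j, hj, hr⟩ := h.exists_extreme (d - b)
  obtain ⟨i, h1, h2, h3⟩ := hM j hj
  have k1 := hr c hc a ha
  have k2 := h.le_of_local h1.le h2 (Or.inl h1) hd hb
  have k3 := h.le_of_local h1.le h2 (Or.inl h1) hb hd
  rw [← neg_sub d b, cross_neg_right] at k3
  rw [cross_comm]
  refine ((neg_le_abs _).trans k1).trans ?_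
  rw [cross_comm, abs_neg, abs_le]
  constructor <;> linarith

/-- By the sign conditions the ray of direction -u meets the edge from k_j to k_{j+1}: with w_j =
cross k_j (f j), the vector w_j • (-u) is a combination of k_j and k_{j+1} with the nonnegative
weights cross k_{j+1} u and -cross k_j u. Their sum is cross (f j) u, and |cross v| ≤ T at both ends
of the edge. -/
theorem width_mul_le (h : Calipers n S C A f) {j : ℕ} {u v : ℝ × ℝ} {T : ℝ}
    (h1 : cross (C j - A j) u ≤ 0) (h2 : 0 ≤ cross (C (j + 1) - A (j + 1)) u)
    (hT : ∀ x ∈ S, ∀ y ∈ S, cross v (x - y) ≤ T) :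
    cross (C j - A j) (f j) * |cross v u| ≤ cross (f j) u * T := by
  have t1 := hT _ (h.memC j) _ (h.memA j)
  have t2 := hT _ (h.memA j) _ (h.memC j)
  have t3 := hT _ (h.memC (j + 1)) _ (h.memA (j + 1))
  have t4 := hT _ (h.memA (j + 1)) _ (h.memC (j + 1))
  rw [← neg_sub, cross_neg_right] at t2 t4
  have e := h.step j
  have w := h.width_pos j
  set k := C j - A j
  set l := C (j + 1) - A (j + 1)
  have hf : f j = l - k := by rw [e]; abel
  have hW : cross k (f j) = cross k l := by rw [hf, cross_sub_right, cross_self, sub_zero]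
  have hfu : cross (f j) u = cross l u - cross k u := by rw [hf, cross_sub_left]
  have id : cross k l * cross v u = -(cross l u) * cross v k + cross k u * cross v l := by
    simp only [cross]; ring
  rw [hfu, hW, ← abs_of_pos (show 0 < cross k l from hW ▸ w), ← abs_mul, id, abs_le]
  have a1 := mul_nonneg h2 (sub_nonneg.2 t1)
  have a2 := mul_nonneg h2 (sub_nonneg.2 t2)
  have a3 := mul_nonneg (neg_nonneg.2 h1) (sub_nonneg.2 t3)
  have a4 := mul_nonneg (neg_nonneg.2 h1) (sub_nonneg.2 t4)
  constructor <;> linarith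

/-- Every direction lies between two consecutive contact differences. -/
theorem exists_between (h : Calipers n S C A f) {u : ℝ × ℝ} (hu : cross (C 0 - A 0) u ≤ 0) :
    ∃ j < n, cross (C j - A j) u ≤ 0 ∧ 0 ≤ cross (C (j + 1) - A (j + 1)) u := by
  -- A discrete intermediate value argument: otherwise the sign persists through half a turn,
  -- although k_n = -k_0.
  by_contra! hc
  have : ∀ j ≤ n, 0 < j → cross (C j - A j) u < 0 := by
    intro j
    induction j with
    | zero => intro _ h; omega
    | succ j ih =>
      intro hj _
      rcases Nat.eq_zero_or_pos j with rfl | hp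
      · exact hc 0 (by omega) hu
      · exact hc j (by omega) (ih (by omega) hp).le
  have := this n le_rfl h.pos
  have e := h.shift_sub 0
  rw [zero_add] at e
  rw [e, cross_neg_left] at this
  linarith

/-- Passing from u to -u ensures the sign at the start of the half-turn; this costs only the
absolute value on the right. -/
theorem exists_width_mul_le (h : Calipers n S C A f) {u v : ℝ × ℝ} {T : ℝ}
    (hT : ∀ x ∈ S, ∀ y ∈ S, cross v (x - y) ≤ T) :
    ∃ j < n, cross (C j - A j) (f j) * |cross v u| ≤ |cross (f j) u| * T := by
  have hT0 : 0 ≤ T := by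
    have := hT _ (h.memC 0) _ (h.memC 0)
    simpa [cross] using this
  rcases le_total (cross (C 0 - A 0) u) 0 with hu | hu
  · obtain ⟨j, hj, h1, h2⟩ := h.exists_between hu
    refine ⟨j, hj, (h.width_mul_le h1 h2 hT).trans ?_⟩
    gcongr
    exact le_abs_self _
  · obtain ⟨j, hj, h1, h2⟩ := h.exists_between (u := -u) (by rw [cross_neg_right]; linarith)
    refine ⟨j, hj, ?_⟩
    have := h.width_mul_le h1 h2 hT
    rw [cross_neg_right, cross_neg_right, abs_neg] at this
    refine this.trans ?_
    gcongr
    exact neg_le_abs _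

/-- The area of an enclosing parallelogram with sides `u` and `v`, from below. -/
theorem le_of_enclosing (h : Calipers n S C A f) {N : ℝ}
    (hN : ∀ s < n, ∃ i, (i = s ∨ i = s + n) ∧ ∃ j, cross (C j - A j) (f i) ≤ 0 ∧
      0 ≤ cross (C (j + 1) - A (j + 1)) (f i) ∧
      N * cross (f j) (f i) ≤ cross (C i - A i) (f i) * cross (C j - A j) (f j))
    {u v : ℝ × ℝ} (huv : cross u v ≠ 0)
    (hu : ∀ x ∈ S, ∀ y ∈ S, cross u (x - y) ≤ |cross u v|)
    (hv : ∀ x ∈ S, ∀ y ∈ S, cross v (x - y) ≤ |cross u v|) : N ≤ |cross u v| := by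
  have hT : 0 < |cross u v| := abs_pos.2 huv
  -- First exchange: v gives way to f s. As T is the area itself, it cancels.
  obtain ⟨s, hs, h1⟩ := h.exists_width_mul_le (u := u) hv
  rw [cross_comm v u, abs_neg] at h1
  have h2 := le_of_mul_le_mul_right h1 hT
  obtain ⟨i, hi, j, k1, k2, k3⟩ := hN s hs
  have h3 : cross (C i - A i) (f i) ≤ |cross u (f i)| := by
    rw [cross_comm u, abs_neg]
    rcases hi with rfl | rfl
    · exact h2
    · rw [h.shift_sub, h.shift_dir, cross_neg_left, cross_neg_right, neg_neg, cross_neg_left,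
        abs_neg]
      exact h2
  -- Second exchange: u gives way to f j.
  have h4 := h.width_mul_le k1 k2 hu
  have wi := h.width_pos i
  have wj := h.width_pos j
  have hD : 0 < cross (f j) (f i) := by
    have : 0 < cross (C j - A j) (f j) * |cross u (f i)| := mul_pos wj (wi.trans_le h3)
    exact pos_of_mul_pos_left (this.trans_le h4) hT.le
  have h5 := mul_le_mul_of_nonneg_left h3 wj.le
  refine le_of_mul_le_mul_left (a := cross (f j) (f i)) ?_ hD
  linarith

end Calipers

theorem isLargestQuadrilateral_of_cross_le {S : Set (ℝ × ℝ)} (hS : Convex ℝ S)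
    {F : Fin 4 → ℝ × ℝ} (hF : ∀ i, F i ∈ S)
    (hmax : ∀ a ∈ S, ∀ b ∈ S, ∀ c ∈ S, ∀ d ∈ S,
      cross (c - a) (d - b) ≤ cross (F 2 - F 0) (F 3 - F 1)) : IsLargestQuadrilateral S F := by
  have hq : IsQuadrilateral F := by
    -- Maximality itself forces convex position: each of these competitors replaces one corner by
    -- another corner, and the loss is exactly one of the four orientations.
    have q1 := hmax _ (hF 0) _ (hF 0) _ (hF 2) _ (hF 3)
    have q2 := hmax _ (hF 0) _ (hF 1) _ (hF 1) _ (hF 3)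
    have q3 := hmax _ (hF 0) _ (hF 1) _ (hF 2) _ (hF 0)
    have q4 := hmax _ (hF 3) _ (hF 1) _ (hF 2) _ (hF 3)
    simp only [cross, Prod.fst_sub, Prod.snd_sub] at q1 q2 q3 q4
    intro i j k hij hjk
    fin_cases i <;> fin_cases j <;> fin_cases k <;>
      first
        | exact absurd hij (by decide)
        | exact absurd hjk (by decide)
        | (simp only [orient, Fin.zero_eta, Fin.mk_one, Fin.reduceFinMk]; linarith)
  refine ⟨hq, ?_, fun F' hF' => ?_⟩
  · refine convexHull_min ?_ hS
    rintro _ ⟨i, rfl⟩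
    exact hF i
  · have hm : ∀ i, F' i ∈ S := fun i => hF' (subset_convexHull ℝ _ ⟨i, rfl⟩)
    exact (area_le_of_cross_le fun i j k l => hmax _ (hm i) _ (hm j) _ (hm k) _ (hm l)).trans
      (le_area_of_isQuadrilateral hq)

/-- The common point of the lines `cross u x = α` and `cross v x = β`. -/
noncomputable def lineInter (u v : ℝ × ℝ) (α β : ℝ) : ℝ × ℝ :=
  ((β * u.1 - α * v.1) / cross v u, (β * u.2 - α * v.2) / cross v u)

theorem lineInter_cross {u v : ℝ × ℝ} (h : cross v u ≠ 0) (x : ℝ × ℝ) :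
    lineInter u v (cross u x) (cross v x) = x := by
  ext
  · simp only [lineInter]
    rw [div_eq_iff h]
    simp only [cross]; ring
  · simp only [lineInter]
    rw [div_eq_iff h]
    simp only [cross]; ring

/-- The supporting strips number i and j meet in a parallelogram of area N, and N is a lower bound
by `le_of_enclosing`. In `hN` each direction may be represented by f s or by its negative f (s + n),
since the sweep need not start at direction 0. -/
theorem Calipers.isSmallestParallelogram {n : ℕ} {S : Set (ℝ × ℝ)} {C A f : ℕ → ℝ × ℝ}
    (h : Calipers n S C A f) {i j : ℕ} {N : ℝ} (hD : 0 < cross (f j) (f i))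
    (hval : N * cross (f j) (f i) = cross (C i - A i) (f i) * cross (C j - A j) (f j))
    (hN : ∀ s < n, ∃ i, (i = s ∨ i = s + n) ∧ ∃ j, cross (C j - A j) (f i) ≤ 0 ∧
      0 ≤ cross (C (j + 1) - A (j + 1)) (f i) ∧
      N * cross (f j) (f i) ≤ cross (C i - A i) (f i) * cross (C j - A j) (f j))
    {G : Fin 4 → ℝ × ℝ}
    (h0 : G 0 = lineInter (f i) (f j) (cross (f i) (C i)) (cross (f j) (C j)))
    (h1 : G 1 = lineInter (f i) (f j) (cross (f i) (A i)) (cross (f j) (C j)))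
    (h2 : G 2 = lineInter (f i) (f j) (cross (f i) (A i)) (cross (f j) (A j)))
    (h3 : G 3 = lineInter (f i) (f j) (cross (f i) (C i)) (cross (f j) (A j))) :
    IsSmallestParallelogram S G := by
  have wi := h.width_pos i
  have wj := h.width_pos j
  have ei : cross (C i - A i) (f i) = cross (f i) (A i) - cross (f i) (C i) := by
    rw [cross_comm, cross_sub_right]; ring
  have ej : cross (C j - A j) (f j) = cross (f j) (A j) - cross (f j) (C j) := by
    rw [cross_comm, cross_sub_right]; ring
  have hpar : G 0 + G 2 = G 1 + G 3 := by
    rw [h0, h1, h2, h3]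
    ext <;> simp only [lineInter, Prod.fst_add, Prod.snd_add] <;> ring
  -- The corners come in clockwise order, hence the sign.
  have hor : orient (G 0) (G 1) (G 3) = -N := by
    have : orient (G 0) (G 1) (G 3) = -((cross (f i) (A i) - cross (f i) (C i)) *
        (cross (f j) (A j) - cross (f j) (C j))) / cross (f j) (f i) := by
      rw [h0, h1, h3, eq_div_iff hD.ne']
      simp only [orient, lineInter]
      field_simp
      simp only [cross]
      ring
    rw [this, ← ei, ← ej, ← hval]
    field_simp
  have hNpos : 0 < N := by
    have : 0 < N * cross (f j) (f i) := by rw [hval]; positivity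
    exact pos_of_mul_pos_left this hD.le
  refine ⟨⟨hpar, by rw [hor]; simpa using hNpos.ne'⟩, fun x hx => ?_, fun G' hG' hS => ?_⟩
  · rw [mem_region_parallelogram hpar]
    have a1 := h.support_left i x hx
    have a2 := h.support_right i x hx
    have b1 := h.support_left j x hx
    have b2 := h.support_right j x hx
    rw [cross_sub_right] at a1 a2 b1 b2
    rw [ei] at wi
    rw [ej] at wj
    refine ⟨(cross (f i) x - cross (f i) (C i)) / (cross (f i) (A i) - cross (f i) (C i)),
      (cross (f j) x - cross (f j) (C j)) / (cross (f j) (A j) - cross (f j) (C j)),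
      by positivity, ?_, by positivity, ?_, ?_⟩
    · rw [div_le_one wi]; linarith
    · rw [div_le_one wj]; linarith
    · conv_lhs => rw [← lineInter_cross hD.ne' x]
      rw [h0, h1, h3]
      have hX : cross (f i) x = cross (f i) (C i) +
          (cross (f i) x - cross (f i) (C i)) / (cross (f i) (A i) - cross (f i) (C i)) *
            (cross (f i) (A i) - cross (f i) (C i)) := by
        rw [div_mul_cancel₀ _ wi.ne']; ring
      have hY : cross (f j) x = cross (f j) (C j) +
          (cross (f j) x - cross (f j) (C j)) / (cross (f j) (A j) - cross (f j) (C j)) *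
            (cross (f j) (A j) - cross (f j) (C j)) := by
        rw [div_mul_cancel₀ _ wj.ne']; ring
      generalize (cross (f i) x - cross (f i) (C i)) / (cross (f i) (A i) - cross (f i) (C i)) = s
        at hX ⊢
      generalize (cross (f j) x - cross (f j) (C j)) / (cross (f j) (A j) - cross (f j) (C j)) = t
        at hY ⊢
      rw [hX, hY]
      ext <;> simp only [lineInter, Prod.fst_add, Prod.snd_add, Prod.fst_sub, Prod.snd_sub,
        Prod.smul_fst, Prod.smul_snd, smul_eq_mul] <;> ring
  · rw [area_parallelogram hpar, area_parallelogram hG'.1, hor, abs_neg, abs_of_pos hNpos]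
    gcongr
    rw [orient_eq_cross]
    have hmem := fun x hx => (mem_region_parallelogram hG'.1 x).1 (hS hx)
    refine h.le_of_enclosing hN ?_ (fun x hx y hy => ?_) (fun x hx y hy => ?_)
    · rw [← orient_eq_cross]; exact hG'.2
    -- The coordinates of two points of the parallelogram differ by at most 1, which bounds cross u
    -- on the difference body by the area.
    · obtain ⟨s, t, hs, hs', ht, ht', rfl⟩ := hmem x hx
      obtain ⟨s', t', hs2, hs2', ht2, ht2', rfl⟩ := hmem y hy
      set u := G' 1 - G' 0
      set v := G' 3 - G' 0
      rw [show G' 0 + s • u + t • v - (G' 0 + s' • u + t' • v) = (s - s') • u + (t - t') • v by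
        module, cross_add_right, cross_smul_right, cross_smul_right, cross_self, mul_zero, zero_add]
      refine (le_abs_self _).trans ?_
      rw [abs_mul]
      refine mul_le_of_le_one_left (abs_nonneg _) (abs_le.2 ⟨by linarith, by linarith⟩)
    · obtain ⟨s, t, hs, hs', ht, ht', rfl⟩ := hmem x hx
      obtain ⟨s', t', hs2, hs2', ht2, ht2', rfl⟩ := hmem y hy
      set u := G' 1 - G' 0
      set v := G' 3 - G' 0
      rw [show G' 0 + s • u + t • v - (G' 0 + s' • u + t' • v) = (s - s') • u + (t - t') • v by
        module, cross_add_right, cross_smul_right, cross_smul_right, cross_self, mul_zero, add_zero]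
      refine (le_abs_self _).trans ?_
      rw [abs_mul, cross_comm, abs_neg]
      refine mul_le_of_le_one_left (abs_nonneg _) (abs_le.2 ⟨by linarith, by linarith⟩)

end ConvexPolygon

/-! ### The program: choosing the two chains and merging them -/

namespace ConvexPolygon

open RealRAM

/-- `reg r := cross (reg a, reg b) (reg c, reg d)`. -/
def crossCode (r a b c d : ℕ) : List Instr :=
  [.mul 60 a d, .mul 61 b c, .sub r 60 61]

/-- Evaluates the base direction on the edge with number `idx 3`. -/
def edgeCode : List Instr :=
  [.idxCopy 8 3, .idxInc 8, .load 20 0 3, .load 21 1 3, .load 22 0 8, .load 23 1 8,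
    .sub 24 22 20, .sub 25 23 21] ++ crossCode 30 17 18 24 25

/-- Closes the cycle of vertices and computes the base direction. -/
def prepareCode : List Instr :=
  [.idxConst 8 0, .load 20 0 8, .load 21 1 8, .store 0 0 20, .store 1 0 21, .idxConst 9 1,
    .load 22 0 9, .load 23 1 9, .idxCopy 8 0, .idxDec 8, .load 24 0 8, .load 25 1 8,
    .sub 17 22 24, .sub 18 23 25, .const 16 0, .idxConst 3 1] ++ edgeCode

/-- Finds the first edge that does not ascend in the base direction. -/
def splitProgram : Program :=
  .seq (block prepareCode) (.loop (.realLt 16 30) (block (.idxInc 3 :: edgeCode)))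

/-- The vertex coordinates are in the arrays `0` and `1`, with vertex `0` repeated at the end. -/
def HasVertices (n : ℕ) (P : ℕ → ℝ × ℝ) (σ : State) : Prop :=
  σ.idx 0 = n ∧ σ.reg 16 = 0 ∧ ∀ i ≤ n, σ.arr 0 i = (P i).1 ∧ σ.arr 1 i = (P i).2

/-- The invariant of the search for the split. -/
def SplitInv (n : ℕ) (P : ℕ → ℝ × ℝ) (σ : State) : Prop :=
  HasVertices n P σ ∧ σ.reg 17 = (baseDir n P).1 ∧ σ.reg 18 = (baseDir n P).2 ∧
    0 < σ.idx 3 ∧ σ.idx 3 < n ∧ (∀ i < σ.idx 3, 0 < cross (baseDir n P) (edge P i)) ∧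
    σ.reg 30 = cross (baseDir n P) (edge P (σ.idx 3))

/-- Edge 0 ascends and edge n - 1 descends, so the search may start at edge 1 and stops before n. -/
theorem splitProgram_spec {n : ℕ} {P : ℕ → ℝ × ℝ} (h : ConvexCycle n P) {σ : State}
    (h0 : σ.idx 0 = n) (hin : ∀ i < n, σ.arr 0 i = (P i).1 ∧ σ.arr 1 i = (P i).2) :
    Runs splitProgram σ (fun τ k => HasVertices n P τ ∧ IsSplit n P (τ.idx 3) ∧
      k ≤ 20 * n + 40) := by
  have hn := h.three_le
  refine Runs.seq (Q := fun τ k => SplitInv n P τ ∧ k = 28)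
    (Runs.block (by simp [prepareCode, edgeCode, crossCode, SafeList, Instr.Safe]) ?_) ?_
  · have a0 := hin 0 (by omega)
    have a1 := hin 1 (by omega)
    have a2 := hin 2 (by omega)
    have al := hin (n - 1) (by omega)
    have n1 : n - 1 ≠ n := by omega
    refine ⟨⟨⟨?_, ?_, fun i hi => ?_⟩, ?_, ?_, ?_, ?_, ?_, ?_⟩, ?_⟩
    · simp [prepareCode, edgeCode, crossCode, run, Instr.apply, Function.update_apply, h0]
    · simp [prepareCode, edgeCode, crossCode, run, Instr.apply, Function.update_apply]
    · rcases hi.eq_or_lt with rfl | hi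
      · simp [prepareCode, edgeCode, crossCode, run, Instr.apply, Function.update_apply, h0, a0,
          h.vertex_n]
      · simp [prepareCode, edgeCode, crossCode, run, Instr.apply, Function.update_apply, h0,
          hi.ne, hin i hi]
    · simp [prepareCode, edgeCode, crossCode, run, Instr.apply, Function.update_apply, h0, baseDir,
        a1, al, n1, show 1 ≠ n by omega]
    · simp [prepareCode, edgeCode, crossCode, run, Instr.apply, Function.update_apply, h0, baseDir,
        a1, al, n1, show 1 ≠ n by omega]
    · simp [prepareCode, edgeCode, crossCode, run, Instr.apply, Function.update_apply]
    · simp [prepareCode, edgeCode, crossCode, run, Instr.apply, Function.update_apply]; omega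
    · intro i hi
      simp [prepareCode, edgeCode, crossCode, run, Instr.apply, Function.update_apply] at hi
      rw [hi]; exact h.baseDir_first
    · simp [prepareCode, edgeCode, crossCode, run, Instr.apply, h0, baseDir,
        a1, a2, al, n1, show 1 ≠ n by omega, show 2 ≠ n by omega, cross, edge]
    · simp [prepareCode, edgeCode, crossCode]
  · rintro τ k ⟨hI, rfl⟩
    refine (Runs.loop (SplitInv n P) (fun σ => 20 * (n - σ.idx 3)) ?_ hI).mono ?_
    · rintro σ ⟨⟨i0, r16, hv⟩, r17, r18, hp, hlt, hasc, r30⟩ hb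
      rw [Test.Holds, r16, r30] at hb
      have hlt' : σ.idx 3 + 1 < n := by
        by_contra hc
        have e : σ.idx 3 = n - 1 := by omega
        rw [e] at hb
        exact absurd hb (not_lt.2 h.baseDir_last.le)
      refine Runs.block (by simp [edgeCode, crossCode, SafeList, Instr.Safe])
        ⟨⟨⟨?_, ?_, fun i hi => ?_⟩, ?_, ?_, ?_, ?_, ?_, ?_⟩, ?_⟩
      · simp [edgeCode, crossCode, run, Instr.apply, i0]
      · simp [edgeCode, crossCode, run, Instr.apply, r16]
      · simp [edgeCode, crossCode, run, Instr.apply, hv i hi]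
      · simp [edgeCode, crossCode, run, Instr.apply, r17]
      · simp [edgeCode, crossCode, run, Instr.apply, r18]
      · simp [edgeCode, crossCode, run, Instr.apply]
      · simpa [edgeCode, crossCode, run, Instr.apply, Function.update_apply] using hlt'
      · intro i hi
        simp [edgeCode, crossCode, run, Instr.apply] at hi
        rcases hi.eq_or_lt with rfl | hi
        · exact hb
        · exact hasc i hi
      · simp [edgeCode, crossCode, run, Instr.apply, r17, r18,
          hv _ hlt'.le, hv (σ.idx 3 + 1 + 1) hlt', cross, edge]
      · simp [edgeCode, crossCode, run, Instr.apply]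
        omega
    · rintro υ l ⟨⟨hv, -, -, hp, hlt, hasc, r30⟩, hb, hl⟩
      rw [Test.Holds, hv.2.1, r30, not_lt] at hb
      exact ⟨hv, ⟨hp, hlt, hasc, hb⟩, by omega⟩

/-- Loads the current vertices of the two chains and compares the next edges. -/
def mergeLoadCode : List Instr :=
  [.load 20 0 4, .load 21 1 4, .load 22 0 5, .load 23 1 5, .idxCopy 8 4, .idxInc 8, .load 24 0 8,
    .load 25 1 8, .idxCopy 9 5, .idxInc 9, .load 26 0 9, .load 27 1 9, .sub 28 24 20,
    .sub 29 25 21, .sub 30 22 26, .sub 31 23 27] ++ crossCode 34 28 29 30 31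

/-- Selects the next edge of the right chain. -/
def rightCode : List Instr := [.copy 35 28, .copy 36 29, .idxInc 4]

/-- Selects the next edge of the left chain. -/
def leftCode : List Instr := [.copy 35 30, .copy 36 31, .idxInc 5]

/-- One step of the merge. -/
def mergeChoice : Program :=
  .ite (.idxLt 4 3)
    (.ite (.idxLt 5 0) (.ite (.realLe 16 34) (block rightCode) (block leftCode)) (block rightCode))
    (block leftCode)

/-- Stores contact points, their difference and the direction in the arrays `2, …, 9`, for both
half-turns. -/
def mergeStoreCode : List Instr :=
  [.store 2 1 20, .store 3 1 21, .store 4 1 22, .store 5 1 23,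
    .store 2 6 22, .store 3 6 23, .store 4 6 20, .store 5 6 21,
    .sub 37 20 22, .sub 38 21 23, .store 6 1 37, .store 7 1 38,
    .sub 39 16 37, .sub 40 16 38, .store 6 6 39, .store 7 6 40,
    .store 8 1 35, .store 9 1 36, .sub 39 16 35, .sub 40 16 36, .store 8 6 39, .store 9 6 40,
    .idxInc 1, .idxInc 6]

/-- The whole merge. -/
def mergeProgram : Program :=
  .seq (block [.idxConst 1 0, .idxCopy 6 0, .idxConst 4 0, .idxCopy 5 3])
    (.loop (.idxLt 1 0)
      (.seq (block mergeLoadCode) (.seq mergeChoice (block mergeStoreCode))))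

/-- The cells number `s` of the arrays `2, …, 9` hold the data of a sequence of calipers. -/
def Stored (C A f : ℕ → ℝ × ℝ) (σ : State) (s : ℕ) : Prop :=
  σ.arr 2 s = (C s).1 ∧ σ.arr 3 s = (C s).2 ∧ σ.arr 4 s = (A s).1 ∧ σ.arr 5 s = (A s).2 ∧
    σ.arr 6 s = (C s - A s).1 ∧ σ.arr 7 s = (C s - A s).2 ∧
    σ.arr 8 s = (f s).1 ∧ σ.arr 9 s = (f s).2

/-- The part of the invariant of the merge that all its parts preserve. -/
def MergeBase (n : ℕ) (P : ℕ → ℝ × ℝ) (m t : ℕ) (σ : State) : Prop :=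
  HasVertices n P σ ∧ σ.idx 3 = m ∧ σ.idx 1 = t ∧ σ.idx 6 = n + t ∧
    ∀ s < t, Stored (mergeC n P m) (mergeA n P m) (mergeF n P m) σ s ∧
      Stored (mergeC n P m) (mergeA n P m) (mergeF n P m) σ (s + n)

/-- The invariant of the merge. -/
def MergeLoopInv (n : ℕ) (P : ℕ → ℝ × ℝ) (m : ℕ) (σ : State) : Prop :=
  ∃ t ≤ n, MergeBase n P m t σ ∧ (σ.idx 4, σ.idx 5) = mergeState n P m t

theorem merge_right {n m t : ℕ} {P : ℕ → ℝ × ℝ} {c a : ℕ} (hs : mergeState n P m t = (c, a))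
    (h : c < m ∧ (a < n → 0 ≤ cross (edge P c) (-edge P a))) :
    mergeState n P m (t + 1) = (c + 1, a) ∧ mergeDir n P m t = edge P c := by
  rw [mergeState_succ, hs, mergeStep, mergeDir, hs]
  exact ⟨if_pos h, if_pos h⟩

theorem merge_left {n m t : ℕ} {P : ℕ → ℝ × ℝ} {c a : ℕ} (hs : mergeState n P m t = (c, a))
    (h : ¬ (c < m ∧ (a < n → 0 ≤ cross (edge P c) (-edge P a)))) :
    mergeState n P m (t + 1) = (c, a + 1) ∧ mergeDir n P m t = -edge P a := by
  rw [mergeState_succ, hs, mergeStep, mergeDir, hs]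
  exact ⟨if_neg h, if_neg h⟩

/-- The memory after the choice of a direction, before it is stored. -/
def MergeChosen (n : ℕ) (P : ℕ → ℝ × ℝ) (m t : ℕ) (σ : State) : Prop :=
  MergeBase n P m t σ ∧ (σ.idx 4, σ.idx 5) = mergeState n P m (t + 1) ∧
    σ.reg 20 = (P (mergeState n P m t).1).1 ∧ σ.reg 21 = (P (mergeState n P m t).1).2 ∧
    σ.reg 22 = (P (mergeState n P m t).2).1 ∧ σ.reg 23 = (P (mergeState n P m t).2).2 ∧
    σ.reg 35 = (mergeDir n P m t).1 ∧ σ.reg 36 = (mergeDir n P m t).2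

theorem mergeChoice_spec {n m t : ℕ} {P : ℕ → ℝ × ℝ} (h : ConvexCycle n P) (hm : IsSplit n P m)
    (ht : t < n) {σ : State} (hB : MergeBase n P m t σ)
    (hs : (σ.idx 4, σ.idx 5) = mergeState n P m t) :
    Runs (.seq (block mergeLoadCode) mergeChoice) σ
      (fun τ k => MergeChosen n P m t τ ∧ k ≤ 30) := by
  obtain ⟨⟨i0, r16, hv⟩, i3, i1, i6, hst⟩ := hB
  have I := mergeInv h hm ht.le
  have hleft := left_lt_of_merge h hm ht
  obtain ⟨c, a, hca⟩ : ∃ c a, mergeState n P m t = (c, a) := ⟨_, _, rfl⟩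
  rw [hca] at hs I hleft
  obtain ⟨i4, i5⟩ := Prod.mk.inj hs
  have Ic := I.right_le
  have Ia := I.left_le
  dsimp only at Ic Ia hleft
  have hmn := hm.lt
  have vc := hv c (by omega)
  have va := hv a Ia
  have hright : c < m → σ.arr 0 (c + 1) = (P (c + 1)).1 ∧ σ.arr 1 (c + 1) = (P (c + 1)).2 :=
    fun hc => hv _ (by omega)
  -- For a = n the load reads cell n + 1, whose content is arbitrary; the comparison that depends on
  -- it is then not evaluated.
  have hleft' : a < n → σ.arr 0 (a + 1) = (P (a + 1)).1 ∧ σ.arr 1 (a + 1) = (P (a + 1)).2 :=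
    fun ha => hv _ (by omega)
  refine Runs.seq (Q := fun τ k => τ = run mergeLoadCode σ ∧ k = 20)
    (Runs.block (by simp [mergeLoadCode, crossCode, SafeList, Instr.Safe])
      ⟨rfl, by simp [mergeLoadCode, crossCode]⟩) ?_
  rintro τ k ⟨rfl, rfl⟩
  have goR : (c < m ∧ (a < n → 0 ≤ cross (edge P c) (-edge P a))) →
      Runs (block rightCode) (run mergeLoadCode σ)
        (fun τ k => MergeChosen n P m t τ ∧ k = 4) := by
    intro hc
    obtain ⟨e1, e2⟩ := merge_right hca hc
    have := hright hc.1
    refine Runs.block (by simp [rightCode, SafeList, Instr.Safe])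
      ⟨⟨⟨⟨?_, ?_, ?_⟩, ?_, ?_, ?_, ?_⟩, ?_, ?_, ?_, ?_, ?_, ?_, ?_⟩, ?_⟩ <;>
      simp [rightCode, mergeLoadCode, crossCode, run, Instr.apply, i0, r16,
        i3, i1, i6, e1, e2, i4, i5, hca, vc, va, edge, this]
    · exact hv
    · exact hst
  have goL : (¬ (c < m ∧ (a < n → 0 ≤ cross (edge P c) (-edge P a)))) → a < n →
      Runs (block leftCode) (run mergeLoadCode σ)
        (fun τ k => MergeChosen n P m t τ ∧ k = 4) := by
    intro hc ha
    obtain ⟨e1, e2⟩ := merge_left hca hc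
    have := hleft' ha
    refine Runs.block (by simp [leftCode, SafeList, Instr.Safe])
      ⟨⟨⟨⟨?_, ?_, ?_⟩, ?_, ?_, ?_, ?_⟩, ?_, ?_, ?_, ?_, ?_, ?_, ?_⟩, ?_⟩ <;>
      simp [leftCode, mergeLoadCode, crossCode, run, Instr.apply, i0, r16,
        i3, i1, i6, e1, e2, i4, i5, hca, vc, va, edge, this]
    · exact hv
    · exact hst
  have b1 : (Test.idxLt 4 3).Holds (run mergeLoadCode σ) ↔ c < m := by
    simp [Test.Holds, mergeLoadCode, crossCode, run, Instr.apply, i4, i3]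
  have b2 : (Test.idxLt 5 0).Holds (run mergeLoadCode σ) ↔ a < n := by
    simp [Test.Holds, mergeLoadCode, crossCode, run, Instr.apply, i5, i0]
  have b3 : c < m → a < n → ((Test.realLe 16 34).Holds (run mergeLoadCode σ) ↔
      0 ≤ cross (edge P c) (-edge P a)) := by
    intro hc ha
    simp [Test.Holds, mergeLoadCode, crossCode, run, Instr.apply, i4, i5,
      r16, vc, va, hright hc, hleft' ha, cross, edge]
  refine Runs.ite (fun h1 => Runs.ite (fun h2 => Runs.ite (fun h3 => ?_) (fun h3 => ?_))
    (fun h2 => ?_)) (fun h1 => ?_)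
  · rw [b1] at h1; rw [b2] at h2; rw [b3 h1 h2] at h3
    exact (goR ⟨h1, fun _ => h3⟩).mono fun τ k hk => ⟨hk.1, by omega⟩
  · rw [b1] at h1; rw [b2] at h2; rw [b3 h1 h2] at h3
    exact (goL (fun hc => h3 (hc.2 h2)) h2).mono fun τ k hk => ⟨hk.1, by omega⟩
  · rw [b1] at h1; rw [b2] at h2
    exact (goR ⟨h1, fun ha => absurd ha h2⟩).mono fun τ k hk => ⟨hk.1, by omega⟩
  · rw [b1] at h1
    exact (goL (fun hc => h1 hc.1) (hleft fun hc => absurd hc h1)).mono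
      fun τ k hk => ⟨hk.1, by omega⟩

theorem mergeStoreCode_spec {n m t : ℕ} {P : ℕ → ℝ × ℝ} (ht : t < n)
    {σ : State} (hI : MergeChosen n P m t σ) :
    MergeBase n P m (t + 1) (run mergeStoreCode σ) ∧
      ((run mergeStoreCode σ).idx 4, (run mergeStoreCode σ).idx 5) = mergeState n P m (t + 1) := by
  obtain ⟨⟨⟨i0, r16, hv⟩, i3, i1, i6, hst⟩, hs, r20, r21, r22, r23, r35, r36⟩ := hI
  have hn : 0 < n := by omega
  have bC : mergeC n P m t = P (mergeState n P m t).1 := alternate_of_lt _ _ ht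
  have bA : mergeA n P m t = P (mergeState n P m t).2 := alternate_of_lt _ _ ht
  have bF : mergeF n P m t = mergeDir n P m t := alternate_of_lt _ _ ht
  have sC : mergeC n P m (t + n) = P (mergeState n P m t).2 := by
    rw [mergeC, alternate_add hn, alternate_of_lt _ _ ht]
  have sA : mergeA n P m (t + n) = P (mergeState n P m t).1 := by
    rw [mergeA, alternate_add hn, alternate_of_lt _ _ ht]
  have sF : mergeF n P m (t + n) = -mergeDir n P m t := by
    rw [mergeF, alternate_add hn, alternate_of_lt _ _ ht]
  refine ⟨⟨⟨?_, ?_, ?_⟩, ?_, ?_, ?_, fun s hst' => ?_⟩, ?_⟩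
  · simp [mergeStoreCode, run, Instr.apply, i0]
  · simp [mergeStoreCode, run, Instr.apply, r16]
  · simp [mergeStoreCode, run, Instr.apply]
    exact hv
  · simp [mergeStoreCode, run, Instr.apply, i3]
  · simp [mergeStoreCode, run, Instr.apply, i1]
  · simp [mergeStoreCode, run, Instr.apply, i6]; ring
  · rcases (Nat.le_of_lt_succ hst').eq_or_lt with rfl | hlt
    · have h1 : s ≠ n + s := by omega
      have h2 : s + n = n + s := by omega
      have h3 : n + s ≠ s := by omega
      rw [Stored, Stored, bC, bA, bF, sC, sA, sF, h2]
      simp [mergeStoreCode, run, Instr.apply, i1, i6, r20, r21, r22, r23,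
        r35, r36, r16, hn.ne']
    · have h1 : s ≠ t := by omega
      have h2 : s ≠ n + t := by omega
      have h3 : s + n ≠ t := by omega
      have h4 : s + n ≠ n + t := by omega
      have := hst s hlt
      simp only [Stored] at this ⊢
      simpa [mergeStoreCode, run, Instr.apply, Function.update_apply, i1, i6, h1, h2, h3, h4]
        using this
  · rw [← hs]
    simp [mergeStoreCode, run, Instr.apply]

theorem mergeProgram_spec {n m : ℕ} {P : ℕ → ℝ × ℝ} (h : ConvexCycle n P) (hm : IsSplit n P m)
    {σ : State} (hv : HasVertices n P σ) (h3 : σ.idx 3 = m) :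
    Runs mergeProgram σ (fun τ k => (τ.idx 0 = n ∧ ∀ s < n + n,
      Stored (mergeC n P m) (mergeA n P m) (mergeF n P m) τ s) ∧ k ≤ 60 * n + 10) := by
  refine Runs.seq (Q := fun τ k => (MergeLoopInv n P m τ ∧ τ.idx 1 = 0) ∧ k = 5)
    (Runs.block (by simp [SafeList, Instr.Safe])
      ⟨⟨⟨0, Nat.zero_le _, ⟨⟨?_, ?_, ?_⟩, ?_, ?_, ?_, ?_⟩, ?_⟩, ?_⟩, ?_⟩) ?_
  · simp [run, Instr.apply, hv.1]
  · simp [run, Instr.apply, hv.2.1]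
  · simp [run, Instr.apply]; exact hv.2.2
  · simp [run, Instr.apply, h3]
  · simp [run, Instr.apply]
  · simp [run, Instr.apply, hv.1]
  · intro s hs; omega
  · simp [run, Instr.apply, h3, mergeState]
  · simp [run, Instr.apply]
  · simp
  · rintro τ k ⟨⟨hI, h1⟩, rfl⟩
    refine (Runs.loop (MergeLoopInv n P m) (fun σ => 60 * (n - σ.idx 1)) ?_ hI).mono ?_
    · rintro σ ⟨t, ht, hB, hs⟩ hb
      have ht' : t < n := by
        rw [Test.Holds, hB.2.2.1, hB.1.1] at hb
        exact hb
      obtain ⟨τ, k, he, hC, hk⟩ := mergeChoice_spec h hm ht' hB hs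
      have hS := mergeStoreCode_spec ht' hC
      -- The execution is taken apart because the program nests its three pieces to the right,
      -- whereas `mergeChoice_spec` groups the first two.
      cases he with
      | seq e1 e2 =>
        refine ⟨_, _, .seq e1 (.seq e2 (exec_block mergeStoreCode τ ?_)),
          ⟨t + 1, ht', hS.1, hS.2⟩, ?_⟩
        · simp [mergeStoreCode, SafeList, Instr.Safe]
        · rw [hB.2.2.1, hS.1.2.2.1]
          have : mergeStoreCode.length = 24 := rfl
          omega
    · rintro υ l ⟨⟨t, ht, hB, hs⟩, hb, hl⟩
      obtain ⟨⟨i0, -, -⟩, -, i1, -, hst⟩ := hB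
      rw [Test.Holds, i0, i1] at hb
      obtain rfl : t = n := by omega
      refine ⟨⟨i0, fun s hs => ?_⟩, ?_⟩
      · rcases Nat.lt_or_ge s t with h2 | h2
        · exact (hst s h2).1
        · have := (hst (s - t) (by omega)).2
          rwa [Nat.sub_add_cancel h2] at this
      · rw [h1] at hl; omega

end ConvexPolygon

/-! ### The program: sweeping over the pairs of conjugate directions -/

namespace ConvexPolygon

open RealRAM

/-- Loads direction number `idx 2` and evaluates the contact difference `reg 20, reg 21` on it. -/
def evalCode : List Instr := [.load 22 8 2, .load 23 9 2] ++ crossCode 24 20 21 22 23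

/-- The best quadrilateral starts as the degenerate pair of equal diagonals k_0, of value 0. The
value 0 in register 26 means that there is no parallelogram yet. -/
def sweepInitCode : List Instr :=
  [.idxConst 1 0, .idxConst 2 0, .const 16 0, .load 20 6 1, .load 21 7 1, .const 25 0, .const 26 0,
    .idxConst 11 0, .idxConst 12 0, .idxConst 13 0, .idxConst 14 0] ++ evalCode

/-- Advances the second pair of contact points. -/
def nextCode : List Instr := .idxInc 2 :: evalCode

/-- The area of the current quadrilateral. -/
def quadCode : List Instr := [.load 32 6 2, .load 33 7 2] ++ crossCode 34 20 21 32 33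

def quadTakeCode : List Instr := [.copy 25 34, .idxCopy 11 1, .idxCopy 12 2]

/-- Advances the first pair of contact points. -/
def advanceCode : List Instr :=
  [.load 27 8 1, .load 28 9 1] ++ crossCode 29 20 21 27 28 ++
    [.idxCopy 10 1, .idxInc 1, .load 20 6 1, .load 21 7 1] ++ evalCode

/-- The area of the current parallelogram. -/
def paraCode : List Instr :=
  crossCode 35 27 28 22 23 ++ [.load 32 6 2, .load 33 7 2] ++ crossCode 36 32 33 22 23 ++
    [.mul 36 36 29, .div 37 36 35]

def paraTakeCode : List Instr := [.copy 26 37, .idxCopy 13 10, .idxCopy 14 2]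

/-- Records the current parallelogram if it is the best one so far. -/
def paraChoice : Program :=
  .seq (block paraCode) (.ite (.realLe 26 16) (block paraTakeCode)
    (.ite (.realLt 37 26) (block paraTakeCode) (block [])))

/-- Records the current quadrilateral if it is the best one so far. -/
def quadChoice : Program :=
  .seq (block quadCode) (.ite (.realLt 25 34) (block quadTakeCode) (block []))

/-- The guard is 0 < cross k_{j+1} (f i). While it holds, f i lies between k_j and k_{j+1}, so the
pair is a candidate for the parallelogram. -/
def innerLoop : Program := .loop (.realLt 16 24) (.seq paraChoice (block nextCode))

def outerLoop : Program :=
  .loop (.idxLt 1 0) (.seq quadChoice (.seq (block advanceCode) innerLoop))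

/-- Searches for the conjugate of k_0. The directions that it skips recur with opposite sign later
in the sweep, so nothing is recorded. -/
def firstLoop : Program := .loop (.realLt 16 24) (block nextCode)

/-- The best quadrilateral so far has the diagonals number `p` and `q`. -/
def MaxInv (n : ℕ) (C A f : ℕ → ℝ × ℝ) (j : ℕ) (M : ℝ) (p q : ℕ) : Prop :=
  p < n + n ∧ q < n + n ∧ M = cross (C p - A p) (C q - A q) ∧
    ∀ j' < j, ∃ i, 0 < cross (C j' - A j') (f i) ∧ cross (C j' - A j') (f (i + 1)) ≤ 0 ∧
      cross (C j' - A j') (C (i + 1) - A (i + 1)) ≤ M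

theorem MaxInv.step {n : ℕ} {C A f : ℕ → ℝ × ℝ} {j p q i : ℕ} {M : ℝ}
    (h : MaxInv n C A f j M p q) (h1 : 0 < cross (C j - A j) (f i))
    (h2 : cross (C j - A j) (f (i + 1)) ≤ 0) (hj : j < n) (hi : i + 1 < n + n) :
    (M < cross (C j - A j) (C (i + 1) - A (i + 1)) →
      MaxInv n C A f (j + 1) (cross (C j - A j) (C (i + 1) - A (i + 1))) j (i + 1)) ∧
    (¬ M < cross (C j - A j) (C (i + 1) - A (i + 1)) → MaxInv n C A f (j + 1) M p q) := by
  obtain ⟨hp, hq, hM, hall⟩ := h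
  constructor
  · intro hlt
    refine ⟨by omega, hi, rfl, fun j' hj' => ?_⟩
    rcases (Nat.le_of_lt_succ hj').eq_or_lt with rfl | hj'
    · exact ⟨i, h1, h2, le_rfl⟩
    · obtain ⟨i', a, b, c⟩ := hall j' hj'
      exact ⟨i', a, b, c.trans hlt.le⟩
  · intro hle
    refine ⟨hp, hq, hM, fun j' hj' => ?_⟩
    rcases (Nat.le_of_lt_succ hj').eq_or_lt with rfl | hj'
    · exact ⟨i, h1, h2, not_lt.1 hle⟩
    · exact hall j' hj'

/-- The best parallelogram so far has the directions number `p` and `q`, unless `N` vanishes and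
there is none. -/
def MinInv (n : ℕ) (C A f : ℕ → ℝ × ℝ) (i₀ i : ℕ) (N : ℝ) (p q : ℕ) : Prop :=
  (0 < N → p < n + n ∧ q < n + n ∧ 0 < cross (f p) (f q) ∧
    N * cross (f p) (f q) = cross (C q - A q) (f q) * cross (C p - A p) (f p)) ∧
  ∀ i', i₀ ≤ i' → i' < i → 0 < N ∧ ∃ j, cross (C j - A j) (f i') ≤ 0 ∧
    0 ≤ cross (C (j + 1) - A (j + 1)) (f i') ∧
    N * cross (f j) (f i') ≤ cross (C i' - A i') (f i') * cross (C j - A j) (f j)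

/-- Here v is the area belonging to the pair. A smaller N keeps the earlier inequalities valid,
because the sign conditions make cross (f j') (f i') nonnegative. -/
theorem MinInv.step {n : ℕ} {S : Set (ℝ × ℝ)} {C A f : ℕ → ℝ × ℝ} (hc : Calipers n S C A f)
    {i₀ i p q j : ℕ} {N v : ℝ} (h : MinInv n C A f i₀ i N p q)
    (h1 : cross (C j - A j) (f i) ≤ 0) (h2 : 0 < cross (C (j + 1) - A (j + 1)) (f i))
    (hD : 0 < cross (f j) (f i))
    (hv : v = cross (C i - A i) (f i) * cross (C j - A j) (f j) / cross (f j) (f i))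
    (hj : j < n + n) (hi : i < n + n) :
    (N ≤ 0 ∨ v < N → MinInv n C A f i₀ (i + 1) v j i) ∧
    (¬ (N ≤ 0 ∨ v < N) → MinInv n C A f i₀ (i + 1) N p q) := by
  have hval : v * cross (f j) (f i) = cross (C i - A i) (f i) * cross (C j - A j) (f j) := by
    rw [hv, div_mul_cancel₀ _ hD.ne']
  have hvpos : 0 < v := by
    rw [hv]
    exact div_pos (mul_pos (hc.width_pos i) (hc.width_pos j)) hD
  obtain ⟨ha, hb⟩ := h
  constructor
  · intro hlt
    refine ⟨fun _ => ⟨hj, hi, hD, hval⟩, fun i' hi' hi'' => ⟨hvpos, ?_⟩⟩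
    rcases (Nat.le_of_lt_succ hi'').eq_or_lt with rfl | hi''
    · exact ⟨j, h1, h2.le, hval.le⟩
    · obtain ⟨hN, j', k1, k2, k3⟩ := hb i' hi' hi''
      refine ⟨j', k1, k2, le_trans ?_ k3⟩
      have hle : v ≤ N := by
        rcases hlt with h | h
        · linarith
        · exact h.le
      refine mul_le_mul_of_nonneg_right hle ?_
      have e := hc.step j'
      rw [e, cross_add_left] at k2
      linarith
  · intro hn
    rw [not_or, not_le, not_lt] at hn
    refine ⟨ha, fun i' hi' hi'' => ⟨hn.1, ?_⟩⟩
    rcases (Nat.le_of_lt_succ hi'').eq_or_lt with rfl | hi''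
    · exact ⟨j, h1, h2.le, (mul_le_mul_of_nonneg_right hn.2 hD.le).trans hval.le⟩
    · exact (hb i' hi' hi'').2

/-- The memory during the sweep, with contact pair `j` and direction `i` under consideration. -/
def AtPair (n : ℕ) (C A f : ℕ → ℝ × ℝ) (j i : ℕ) (σ : State) : Prop :=
  σ.idx 0 = n ∧ σ.reg 16 = 0 ∧ (∀ s < n + n, Stored C A f σ s) ∧ σ.idx 1 = j ∧ σ.idx 2 = i ∧
    σ.reg 20 = (C j - A j).1 ∧ σ.reg 21 = (C j - A j).2 ∧ σ.reg 22 = (f i).1 ∧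
    σ.reg 23 = (f i).2 ∧ σ.reg 24 = cross (C j - A j) (f i)

/-- The registers that hold the best solutions so far. -/
def BestInv (n : ℕ) (C A f : ℕ → ℝ × ℝ) (i₀ j i : ℕ) (σ : State) : Prop :=
  MaxInv n C A f j (σ.reg 25) (σ.idx 11) (σ.idx 12) ∧
    MinInv n C A f i₀ i (σ.reg 26) (σ.idx 13) (σ.idx 14)

/-! ### Correctness and cost of the sweep. -/

section Sweep

variable {n : ℕ} {S : Set (ℝ × ℝ)} {C A f : ℕ → ℝ × ℝ}

theorem atPair_next {j i : ℕ} {σ : State} (h : AtPair n C A f j i σ) (hi : i + 1 < n + n) :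
    AtPair n C A f j (i + 1) (run nextCode σ) := by
  obtain ⟨i0, r16, hst, i1, i2, r20, r21, r22, r23, r24⟩ := h
  obtain ⟨-, -, -, -, -, -, s8, s9⟩ := hst _ hi
  refine ⟨?_, ?_, ?_, ?_, ?_, ?_, ?_, ?_, ?_, ?_⟩ <;>
    simp [nextCode, evalCode, crossCode, run, Instr.apply, i0, r16, i1, i2, r20, r21, s8, s9,
      cross]
  exact hst

theorem sweepInit_spec (hc : Calipers n S C A f) {σ : State} (h0 : σ.idx 0 = n)
    (hst : ∀ s < n + n, Stored C A f σ s) :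
    AtPair n C A f 0 0 (run sweepInitCode σ) ∧ BestInv n C A f 0 0 0 (run sweepInitCode σ) := by
  have hn := hc.pos
  obtain ⟨-, -, -, -, s6, s7, s8, s9⟩ := hst 0 (by omega)
  refine ⟨⟨?_, ?_, ?_, ?_, ?_, ?_, ?_, ?_, ?_, ?_⟩, ⟨?_, ?_, ?_, ?_⟩, ?_, ?_⟩
  all_goals
    simp [sweepInitCode, evalCode, crossCode, run, Instr.apply, h0, s6, s7, s8, s9, cross_self,
      hn]
  · exact hst
  · simp [cross]

/-- Since f n = -f 0 and the width is positive, the sign has changed by direction n at the latest.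
-/
theorem firstLoop_spec (hc : Calipers n S C A f) {σ : State} (hA : AtPair n C A f 0 0 σ)
    (hB : BestInv n C A f 0 0 0 σ) :
    Runs firstLoop σ (fun τ k => (∃ i, AtPair n C A f 0 i τ ∧ BestInv n C A f i 0 i τ ∧ 0 < i ∧
      i ≤ n ∧ cross (C 0 - A 0) (f i) ≤ 0 ∧ ∀ i' < i, 0 < cross (C 0 - A 0) (f i')) ∧
      k ≤ 10 * n + 1) := by
  have hw := hc.width_pos 0
  have hwn : cross (C 0 - A 0) (f n) < 0 := by
    have := hc.shift_dir 0
    rw [zero_add] at this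
    rw [this, cross_neg_right]
    linarith
  refine (Runs.loop (fun σ => ∃ i ≤ n, AtPair n C A f 0 i σ ∧ BestInv n C A f i 0 i σ ∧
    ∀ i' < i, 0 < cross (C 0 - A 0) (f i')) (fun σ => 10 * (n - σ.idx 2)) ?_
    ⟨0, Nat.zero_le _, hA, hB, fun i' hi' => by omega⟩).mono ?_
  · rintro σ ⟨i, hin, hA, hB, hpos⟩ hb
    rw [Test.Holds, hA.2.1, hA.2.2.2.2.2.2.2.2.2] at hb
    have hlt : i < n := by
      rcases hin.eq_or_lt with rfl | h
      · linarith
      · exact h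
    have hA' := atPair_next hA (by omega)
    refine Runs.block (by simp [nextCode, evalCode, crossCode, SafeList, Instr.Safe])
      ⟨⟨i + 1, hlt, hA', ⟨?_, ?_, fun i' h1 h2 => by omega⟩, fun i' hi' => ?_⟩, ?_⟩
    · simpa [nextCode, evalCode, crossCode, run, Instr.apply] using hB.1
    · simpa [nextCode, evalCode, crossCode, run, Instr.apply] using hB.2.1
    · rcases (Nat.le_of_lt_succ hi').eq_or_lt with rfl | hi'
      · exact hb
      · exact hpos i' hi'
    · rw [hA.2.2.2.2.1, hA'.2.2.2.2.1]
      have : nextCode.length = 6 := rfl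
      omega
  · rintro τ k ⟨⟨i, hin, hA', hB', hpos⟩, hb, hk⟩
    rw [Test.Holds, hA'.2.1, hA'.2.2.2.2.2.2.2.2.2, not_lt] at hb
    rw [hA.2.2.2.2.1] at hk
    refine ⟨⟨i, hA', hB', ?_, hin, hb, hpos⟩, by omega⟩
    rcases Nat.eq_zero_or_pos i with rfl | h
    · linarith
    · exact h

theorem quadChoice_spec {j i i₀ : ℕ} {σ : State} (hA : AtPair n C A f j (i + 1) σ)
    (hB : BestInv n C A f i₀ j (i + 1) σ) (h1 : 0 < cross (C j - A j) (f i))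
    (h2 : cross (C j - A j) (f (i + 1)) ≤ 0) (hj : j < n) (hi : i + 1 < n + n) :
    Runs quadChoice σ (fun τ k => AtPair n C A f j (i + 1) τ ∧
      BestInv n C A f i₀ (j + 1) (i + 1) τ ∧ k ≤ 11) := by
  obtain ⟨i0, r16, hst, i1, i2, r20, r21, r22, r23, r24⟩ := hA
  obtain ⟨-, -, -, -, s6, s7, -, -⟩ := hst _ hi
  have hM := hB.1.step h1 h2 hj hi
  have hb : (Test.realLt 25 34).Holds (run quadCode σ) ↔
      σ.reg 25 < cross (C j - A j) (C (i + 1) - A (i + 1)) := by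
    simp [Test.Holds, quadCode, crossCode, run, Instr.apply, i2, r20, r21, s6, s7, cross]
  refine Runs.seq (Q := fun τ k => τ = run quadCode σ ∧ k = 6)
    (Runs.block (by simp [quadCode, crossCode, SafeList, Instr.Safe]) ⟨rfl, rfl⟩) ?_
  rintro τ k ⟨rfl, rfl⟩
  refine Runs.ite (fun h3 => ?_) (fun h3 => ?_)
  · have hM' := hM.1 (hb.1 h3)
    refine Runs.block (by simp [quadTakeCode, SafeList, Instr.Safe])
      ⟨⟨?_, ?_, ?_, ?_, ?_, ?_, ?_, ?_, ?_, ?_⟩, ⟨?_, ?_⟩, by simp [quadTakeCode]⟩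
    all_goals
      simp [quadTakeCode, quadCode, crossCode, run, Instr.apply, i0, r16, i1, i2, r20, r21, r22,
        r23, r24, s6, s7]
    · exact hst
    · simpa [cross] using hM'
    · exact hB.2
  · have hM' := hM.2 fun h => h3 (hb.2 h)
    refine Runs.block trivial
      ⟨⟨?_, ?_, ?_, ?_, ?_, ?_, ?_, ?_, ?_, ?_⟩, ⟨?_, ?_⟩, by simp⟩
    all_goals
      simp [quadCode, crossCode, run, Instr.apply, i0, r16, i1, i2, r20, r21, r22, r23, r24]
    · exact hst
    · exact hM'
    · exact hB.2

/-- The registers that describe the previous contact pair. -/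
def PrevInv (C A f : ℕ → ℝ × ℝ) (j : ℕ) (σ : State) : Prop :=
  σ.idx 10 = j ∧ σ.reg 27 = (f j).1 ∧ σ.reg 28 = (f j).2 ∧ σ.reg 29 = cross (C j - A j) (f j)

theorem advance_spec {j i i₀ : ℕ} {σ : State} (hA : AtPair n C A f j i σ)
    (hB : BestInv n C A f i₀ (j + 1) i σ) (hj : j + 1 < n + n) (hi : i < n + n) :
    AtPair n C A f (j + 1) i (run advanceCode σ) ∧
      BestInv n C A f i₀ (j + 1) i (run advanceCode σ) ∧ PrevInv C A f j (run advanceCode σ) := by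
  obtain ⟨i0, r16, hst, i1, i2, r20, r21, r22, r23, r24⟩ := hA
  obtain ⟨-, -, -, -, -, -, s8, s9⟩ := hst j (by omega)
  obtain ⟨-, -, -, -, t6, t7, -, -⟩ := hst _ hj
  obtain ⟨-, -, -, -, -, -, u8, u9⟩ := hst _ hi
  refine ⟨⟨?_, ?_, ?_, ?_, ?_, ?_, ?_, ?_, ?_, ?_⟩, ⟨?_, ?_⟩, ?_, ?_, ?_, ?_⟩
  all_goals
    simp [advanceCode, evalCode, crossCode, run, Instr.apply, i0, r16, i1, i2, r20, r21, s8, s9,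
      t6, t7, u8, u9, cross]
  · exact hst
  · exact hB.1
  · exact hB.2

theorem paraChoice_spec (hc : Calipers n S C A f) {j i i₀ : ℕ} {σ : State}
    (hA : AtPair n C A f (j + 1) i σ) (hB : BestInv n C A f i₀ (j + 1) i σ)
    (hP : PrevInv C A f j σ) (h1 : cross (C j - A j) (f i) ≤ 0)
    (h2 : 0 < cross (C (j + 1) - A (j + 1)) (f i)) (hj : j < n + n) (hi : i < n + n) :
    Runs paraChoice σ (fun τ k => AtPair n C A f (j + 1) i τ ∧
      BestInv n C A f i₀ (j + 1) (i + 1) τ ∧ PrevInv C A f j τ ∧ k ≤ 20) := by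
  obtain ⟨i0, r16, hst, i1, i2, r20, r21, r22, r23, r24⟩ := hA
  obtain ⟨i10, r27, r28, r29⟩ := hP
  obtain ⟨-, -, -, -, s6, s7, -, -⟩ := hst _ hi
  -- As f j = k_{j+1} - k_j, the two sign conditions give a nonzero divisor.
  have hD : 0 < cross (f j) (f i) := by
    have := h2
    rw [hc.step j, cross_add_left] at this
    linarith
  have hN := hB.2.step hc h1 h2 hD rfl hj hi
  set v := cross (C i - A i) (f i) * cross (C j - A j) (f j) / cross (f j) (f i) with hv
  have hb1 : (Test.realLe 26 16).Holds (run paraCode σ) ↔ σ.reg 26 ≤ 0 := by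
    simp [Test.Holds, paraCode, crossCode, run, Instr.apply, r16]
  have r37 : (run paraCode σ).reg 37 = v := by
    simp [paraCode, crossCode, run, Instr.apply, i2, r22, r23, r27, r28, r29, s6, s7]
    rw [hv]
    simp [cross]
  have hb2 : (Test.realLt 37 26).Holds (run paraCode σ) ↔ v < σ.reg 26 := by
    rw [Test.Holds, r37]
    simp [paraCode, crossCode, run, Instr.apply]
  have take : σ.reg 26 ≤ 0 ∨ v < σ.reg 26 → Runs (block paraTakeCode) (run paraCode σ)
      (fun τ k => AtPair n C A f (j + 1) i τ ∧
        BestInv n C A f i₀ (j + 1) (i + 1) τ ∧ PrevInv C A f j τ ∧ k ≤ 4) := by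
    intro h3
    have hN' := hN.1 h3
    refine Runs.block (by simp [paraTakeCode, SafeList, Instr.Safe])
      ⟨⟨?_, ?_, ?_, ?_, ?_, ?_, ?_, ?_, ?_, ?_⟩, ⟨?_, ?_⟩, ⟨?_, ?_, ?_, ?_⟩,
        by simp [paraTakeCode]⟩
    case refine_12 =>
      rw [← r37] at hN'
      simp only [paraTakeCode, run, Instr.apply] at hN' ⊢
      simpa [paraCode, crossCode, run, Instr.apply, i10, i2] using hN'
    all_goals
      simp [paraTakeCode, paraCode, crossCode, run, Instr.apply, i0, r16, i1, i2, r20, r21, r22,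
        r23, r24, i10, r27, r28, r29]
    · exact hst
    · exact hB.1
  refine Runs.seq (Q := fun τ k => τ = run paraCode σ ∧ k = 11)
    (Runs.block ?_ ⟨rfl, rfl⟩) ?_
  · simp [paraCode, crossCode, SafeList, Instr.Safe, Instr.apply, r22, r23, r27, r28]
    exact hD.ne'
  rintro τ k ⟨rfl, rfl⟩
  refine Runs.ite (fun h3 => ?_) (fun h3 => Runs.ite (fun h4 => ?_) (fun h4 => ?_))
  · exact (take (Or.inl (hb1.1 h3))).mono fun τ k ⟨a, b, c, d⟩ => ⟨a, b, c, by omega⟩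
  · exact (take (Or.inr (hb2.1 h4))).mono fun τ k ⟨a, b, c, d⟩ => ⟨a, b, c, by omega⟩
  · have hN' := hN.2 (by rw [← hb1, ← hb2]; tauto)
    refine Runs.block trivial
      ⟨⟨?_, ?_, ?_, ?_, ?_, ?_, ?_, ?_, ?_, ?_⟩, ⟨?_, ?_⟩, ⟨?_, ?_, ?_, ?_⟩, by simp⟩
    all_goals
      simp [paraCode, crossCode, run, Instr.apply, i0, r16, i1, i2, r20, r21, r22,
        r23, r24, i10, r27, r28, r29]
    · exact hst
    · exact hB.1
    · exact hN'

/-- The invariant of the inner loop of the sweep, with contact pair `j + 1`. -/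
def InnerInv (n : ℕ) (C A f : ℕ → ℝ × ℝ) (i₀ j : ℕ) (σ : State) : Prop :=
  ∃ i, AtPair n C A f (j + 1) (i + 1) σ ∧ BestInv n C A f i₀ (j + 1) (i + 1) σ ∧
    PrevInv C A f j σ ∧ j ≤ i ∧ i < j + n ∧ i₀ ≤ i + 1 ∧
    cross (C j - A j) (f (i + 1)) ≤ 0 ∧ 0 < cross (C (j + 1) - A (j + 1)) (f i)

/-- The invariant of the outer loop of the sweep. -/
def OuterInv (n : ℕ) (C A f : ℕ → ℝ × ℝ) (i₀ : ℕ) (σ : State) : Prop :=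
  ∃ j i, AtPair n C A f j (i + 1) σ ∧ BestInv n C A f i₀ j (i + 1) σ ∧ j ≤ n ∧ j ≤ i ∧
    i < j + n ∧ i + 1 < n + n ∧ i₀ ≤ i + 1 ∧ cross (C j - A j) (f (i + 1)) ≤ 0 ∧
    0 < cross (C j - A j) (f i)

/-- When the guard fails at i + 1, having been positive at i, this is exactly the conjugacy
condition for k_{j+1}. The unused potential is handed back, so that the outer loop can charge the
inner steps to the advance of the direction index. -/
theorem innerLoop_spec (hc : Calipers n S C A f) {i₀ j : ℕ} (hj : j < n) {σ : State}
    (hI : InnerInv n C A f i₀ j σ) :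
    Runs innerLoop σ (fun τ k => (OuterInv n C A f i₀ τ ∧ τ.idx 1 = j + 1) ∧
      30 * (n + n - τ.idx 2) + k ≤ 30 * (n + n - σ.idx 2) + 1) := by
  refine (Runs.loop (InnerInv n C A f i₀ j) (fun σ => 30 * (n + n - σ.idx 2)) ?_ hI).mono ?_
  · rintro σ ⟨i, hA, hB, hP, hji, hij, hi0, h1, h2⟩ hb
    rw [Test.Holds, hA.2.1, hA.2.2.2.2.2.2.2.2.2] at hb
    -- Direction j + n is -f j, on which k_{j+1} has the value minus the width, so the guard fails
    -- there.
    have hlt : i + 1 < j + n := by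
      by_contra hcon
      have e : i + 1 = j + n := by omega
      rw [e, hc.shift_dir, cross_neg_right, hc.step, cross_add_left, cross_self] at hb
      have := hc.width_pos j
      linarith
    refine Runs.seq (paraChoice_spec hc hA hB hP h1 hb (by omega) (by omega)) ?_
    rintro τ k ⟨hA', hB', hP', hk⟩
    have hA'' := atPair_next hA' (show i + 1 + 1 < n + n by omega)
    refine Runs.block (by simp [nextCode, evalCode, crossCode, SafeList, Instr.Safe])
      ⟨⟨i + 1, hA'', ⟨?_, ?_⟩, ⟨?_, ?_, ?_, ?_⟩, by omega, hlt, by omega, ?_, hb⟩, ?_⟩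
    · simpa [nextCode, evalCode, crossCode, run, Instr.apply] using hB'.1
    · simpa [nextCode, evalCode, crossCode, run, Instr.apply] using hB'.2
    · simpa [nextCode, evalCode, crossCode, run, Instr.apply] using hP'.1
    · simpa [nextCode, evalCode, crossCode, run, Instr.apply] using hP'.2.1
    · simpa [nextCode, evalCode, crossCode, run, Instr.apply] using hP'.2.2.1
    · simpa [nextCode, evalCode, crossCode, run, Instr.apply] using hP'.2.2.2
    -- Once cross k_j is nonpositive on f (i + 1), it stays so on f (i + 2): Plücker relation with f
    -- j, using the angular order up to f (j + n).
    · have hD : 0 < cross (f j) (f (i + 1)) := by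
        rw [hc.step j, cross_add_left] at hb
        linarith
      have s1 := hc.sorted j (i + 1 + 1) (by omega) (by omega)
      have s2 := hc.sorted (i + 1) (i + 1 + 1) (by omega) (by omega)
      have w := hc.width_pos j
      have key := cross_mul_cross (C j - A j) (f j) (f (i + 1 + 1)) (f (i + 1))
      rw [cross_comm (f (i + 1 + 1))] at key
      have := mul_nonneg w.le s2
      have := mul_nonneg (neg_nonneg.2 h1) s1
      by_contra! hcon
      have := mul_pos hcon hD
      linarith
    · rw [hA.2.2.2.2.1, hA''.2.2.2.2.1]
      have : nextCode.length = 6 := rfl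
      omega
  · rintro τ k ⟨⟨i, hA, hB, hP, hji, hij, hi0, h1, h2⟩, hb, hk⟩
    rw [Test.Holds, hA.2.1, hA.2.2.2.2.2.2.2.2.2, not_lt] at hb
    refine ⟨⟨⟨j + 1, i, hA, hB, hj, ?_, by omega, by omega, hi0, hb, h2⟩, hA.2.2.2.1⟩, hk⟩
    -- For i = j the failed guard would be the positive width at j + 1.
    rcases hji.eq_or_lt with rfl | h
    · have := hc.width_pos (j + 1)
      linarith
    · exact h

/-- Neither index decreases: at most n contact pairs at 40 steps and 2 * n directions at 30 steps
give 100 * n. -/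
theorem outerLoop_spec (hc : Calipers n S C A f) {i₀ : ℕ} {σ : State}
    (hI : OuterInv n C A f i₀ σ) (h1 : σ.idx 1 = 0) :
    Runs outerLoop σ (fun τ k => (OuterInv n C A f i₀ τ ∧ τ.idx 1 = n) ∧ k ≤ 100 * n + 1) := by
  refine (Runs.loop (OuterInv n C A f i₀)
    (fun σ => 40 * (n - σ.idx 1) + 30 * (n + n - σ.idx 2)) ?_ hI).mono ?_
  · rintro σ ⟨j, i, hA, hB, hjn, hji, hij, hin, hi0, h1, h2⟩ hb
    rw [Test.Holds, hA.1, hA.2.2.2.1] at hb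
    refine Runs.seq (quadChoice_spec hA hB h2 h1 hb hin) ?_
    rintro τ k ⟨hA', hB', hk⟩
    have hadv := advance_spec hA' hB' (by omega) hin
    refine Runs.seq (Q := fun τ' k' => τ' = run advanceCode τ ∧ k' = 15)
      (Runs.block (by simp [advanceCode, evalCode, crossCode, SafeList, Instr.Safe])
        ⟨rfl, rfl⟩) ?_
    rintro τ' k' ⟨rfl, rfl⟩
    refine (innerLoop_spec hc hb (i₀ := i₀) ⟨i, hadv.1, hadv.2.1, hadv.2.2, hji, hij, hi0, h1,
      ?_⟩).mono ?_
    · rw [hc.step, cross_add_left]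
      have := hc.sorted j i hji hij.le
      linarith
    · rintro υ l ⟨⟨hO, hi1⟩, hl⟩
      refine ⟨hO, ?_⟩
      rw [hadv.1.2.2.2.2.1] at hl
      rw [hA.2.2.2.2.1, hA.2.2.2.1, hi1]
      omega
  · rintro τ k ⟨⟨j, i, hA, hB, hjn, hrest⟩, hb, hk⟩
    have e := hA.2.2.2.1
    rw [Test.Holds, hA.1, e] at hb
    refine ⟨⟨⟨j, i, hA, hB, hjn, hrest⟩, by omega⟩, by omega⟩

end Sweep

end ConvexPolygon

/-! ### The output -/

namespace ConvexPolygon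

open RealRAM

/-- Writes the best quadrilateral to the registers `0, …, 7` and loads the data of the best
parallelogram. -/
def resultCode : List Instr :=
  [.load 0 4 11, .load 1 5 11, .load 2 4 12, .load 3 5 12, .load 4 2 11, .load 5 3 11,
    .load 6 2 12, .load 7 3 12,
    .load 40 8 14, .load 41 9 14, .load 42 8 13, .load 43 9 13,
    .load 44 2 14, .load 45 3 14, .load 46 4 14, .load 47 5 14,
    .load 48 2 13, .load 49 3 13, .load 50 4 13, .load 51 5 13] ++
    crossCode 52 42 43 40 41 ++ crossCode 53 40 41 44 45 ++ crossCode 54 40 41 46 47 ++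
    crossCode 55 42 43 48 49 ++ crossCode 56 42 43 50 51

/-- Writes the corner with the line parameters `reg a` and `reg b` to the registers `r`, `s`. -/
def cornerCode (r s a b : ℕ) : List Instr :=
  [.mul 60 b 40, .mul 61 a 42, .sub 60 60 61, .div r 60 52,
    .mul 60 b 41, .mul 61 a 43, .sub 60 60 61, .div s 60 52]

def cornersCode : List Instr :=
  cornerCode 8 9 53 55 ++ cornerCode 10 11 54 55 ++ cornerCode 12 13 54 56 ++
    cornerCode 14 15 53 56

/-- The sweep and the output. -/
def sweepProgram : Program :=
  .seq (block sweepInitCode) (.seq firstLoop (.seq outerLoop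
    (.seq (block resultCode) (block cornersCode))))

theorem cornersCode_quadrilateral (σ : State) : output (run cornersCode σ) 0 = output σ 0 := by
  ext i <;> fin_cases i <;> simp [output, cornersCode, cornerCode, run, Instr.apply]

theorem cornersCode_parallelogram {u v : ℝ × ℝ} {α α' β β' : ℝ} {σ : State}
    (r40 : σ.reg 40 = u.1) (r41 : σ.reg 41 = u.2) (r42 : σ.reg 42 = v.1) (r43 : σ.reg 43 = v.2)
    (r52 : σ.reg 52 = cross v u) (r53 : σ.reg 53 = α) (r54 : σ.reg 54 = α')
    (r55 : σ.reg 55 = β) (r56 : σ.reg 56 = β') :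
    output (run cornersCode σ) 8 0 = lineInter u v α β ∧
      output (run cornersCode σ) 8 1 = lineInter u v α' β ∧
      output (run cornersCode σ) 8 2 = lineInter u v α' β' ∧
      output (run cornersCode σ) 8 3 = lineInter u v α β' := by
  refine ⟨?_, ?_, ?_, ?_⟩ <;> ext <;>
    simp [output, cornersCode, cornerCode, run, Instr.apply, lineInter, r40, r41, r42, r43, r52,
      r53, r54, r55, r56]

section Sweep

variable {n : ℕ} {S : Set (ℝ × ℝ)} {C A f : ℕ → ℝ × ℝ}

/-- The n consecutive directions from i₀ on represent all directions up to sign. -/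
theorem MinInv.cover (hc : Calipers n S C A f) {i₀ i p q : ℕ} {N : ℝ}
    (h : MinInv n C A f i₀ i N p q) (h0 : i₀ ≤ n) (hi : i₀ + n ≤ i) :
    0 < N ∧ ∀ s < n, ∃ i, (i = s ∨ i = s + n) ∧ ∃ j, cross (C j - A j) (f i) ≤ 0 ∧
      0 ≤ cross (C (j + 1) - A (j + 1)) (f i) ∧
      N * cross (f j) (f i) ≤ cross (C i - A i) (f i) * cross (C j - A j) (f j) := by
  refine ⟨(h.2 i₀ le_rfl (by have := hc.pos; omega)).1, fun s hs => ?_⟩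
  rcases Nat.lt_or_ge s i₀ with h1 | h1
  · exact ⟨s + n, Or.inr rfl, (h.2 (s + n) (by omega) (by omega)).2⟩
  · exact ⟨s, Or.inl rfl, (h.2 s h1 (by omega)).2⟩

theorem sweepProgram_spec (hc : Calipers n S C A f) (hS : Convex ℝ S) {σ : State}
    (h0 : σ.idx 0 = n) (hst : ∀ s < n + n, Stored C A f σ s) :
    Runs sweepProgram σ (fun τ k => (IsLargestQuadrilateral S (output τ 0) ∧
      IsSmallestParallelogram S (output τ 8)) ∧ k ≤ 110 * n + 100) := by
  have hinit := sweepInit_spec hc h0 hst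
  refine Runs.seq (Q := fun τ k => τ = run sweepInitCode σ ∧ k = 17)
    (Runs.block (by simp [sweepInitCode, evalCode, crossCode, SafeList, Instr.Safe])
      ⟨rfl, rfl⟩) ?_
  rintro τ₁ k₁ ⟨rfl, rfl⟩
  refine Runs.seq (firstLoop_spec hc hinit.1 hinit.2) ?_
  rintro τ₂ k₂ ⟨⟨i₀, hA, hB, hi0, hi0n, hle, hlt⟩, hk₂⟩
  obtain ⟨i, rfl⟩ := Nat.exists_eq_succ_of_ne_zero hi0.ne'
  have hn2 : i + 1 < n + n := by have := hc.pos; omega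
  refine Runs.seq (outerLoop_spec hc (i₀ := i + 1) ⟨0, i, hA, hB, Nat.zero_le _, Nat.zero_le _,
    by omega, hn2, le_rfl, hle, hlt i (by omega)⟩ hA.2.2.2.1) ?_
  rintro τ k₃ ⟨⟨⟨j, l, hA', ⟨hM, hN⟩, hjn, hjl, hln, -, -, hle', -⟩, hj⟩, hk₃⟩
  obtain rfl : j = n := hA'.2.2.2.1.symm.trans hj
  obtain ⟨l, rfl⟩ := Nat.exists_eq_add_of_le' hjl
  -- Half a turn later the pair is -k_0 and the directions are negated, so the direction index must
  -- have advanced by at least n; otherwise the final sign condition contradicts the minimality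
  -- found by the first loop.
  have hcov : i + 1 + j ≤ l + j + 1 := by
    by_contra hcon
    have h1 := hlt (l + 1) (by omega)
    have h2 := hc.shift_sub 0
    rw [zero_add] at h2
    rw [show l + j + 1 = l + 1 + j by ring, hc.shift_dir, h2, cross_neg_left, cross_neg_right,
      neg_neg] at hle'
    linarith
  obtain ⟨hNpos, hcover⟩ := MinInv.cover hc hN hi0n hcov
  obtain ⟨hp, hq, hD, hval⟩ := hN.1 hNpos
  obtain ⟨hp', hq', hMval, hMall⟩ := hM
  have hst' := hA'.2.2.1
  obtain ⟨a2, a3, a4, a5, -, -, -, -⟩ := hst' _ hp'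
  obtain ⟨b2, b3, b4, b5, -, -, -, -⟩ := hst' _ hq'
  obtain ⟨c2, c3, c4, c5, -, -, c8, c9⟩ := hst' _ hp
  obtain ⟨d2, d3, d4, d5, -, -, d8, d9⟩ := hst' _ hq
  refine Runs.seq (Q := fun υ k => υ = run resultCode τ ∧ k = 36)
    (Runs.block (by simp [resultCode, crossCode, SafeList, Instr.Safe])
      ⟨rfl, rfl⟩) ?_
  rintro υ k₄ ⟨rfl, rfl⟩
  set u := f (τ.idx 14)
  set v := f (τ.idx 13)
  have r40 : (run resultCode τ).reg 40 = u.1 := by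
    simpa [resultCode, crossCode, run, Instr.apply] using d8
  have r41 : (run resultCode τ).reg 41 = u.2 := by
    simpa [resultCode, crossCode, run, Instr.apply] using d9
  have r42 : (run resultCode τ).reg 42 = v.1 := by
    simpa [resultCode, crossCode, run, Instr.apply] using c8
  have r43 : (run resultCode τ).reg 43 = v.2 := by
    simpa [resultCode, crossCode, run, Instr.apply] using c9
  have r52 : (run resultCode τ).reg 52 = cross v u := by
    simp [resultCode, crossCode, run, Instr.apply, c8, c9, d8, d9, cross]
  have r53 : (run resultCode τ).reg 53 = cross u (C (τ.idx 14)) := by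
    simp [resultCode, crossCode, run, Instr.apply, d2, d3, d8, d9, cross]
  have r54 : (run resultCode τ).reg 54 = cross u (A (τ.idx 14)) := by
    simp [resultCode, crossCode, run, Instr.apply, d4, d5, d8, d9, cross]
  have r55 : (run resultCode τ).reg 55 = cross v (C (τ.idx 13)) := by
    simp [resultCode, crossCode, run, Instr.apply, c2, c3, c8, c9, cross]
  have r56 : (run resultCode τ).reg 56 = cross v (A (τ.idx 13)) := by
    simp [resultCode, crossCode, run, Instr.apply, c4, c5, c8, c9, cross]
  refine Runs.block ?_ ⟨⟨?_, ?_⟩, ?_⟩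
  · simp [cornersCode, cornerCode, SafeList, Instr.Safe, Instr.apply, r52, hD.ne']
  · rw [cornersCode_quadrilateral]
    -- With corners A p, A q, C p, C q the diagonals are k_p and k_q.
    have q0 : output (run resultCode τ) 0 0 = A (τ.idx 11) := by
      ext <;> simp [output, resultCode, crossCode, run, Instr.apply, a4, a5]
    have q1 : output (run resultCode τ) 0 1 = A (τ.idx 12) := by
      ext <;> simp [output, resultCode, crossCode, run, Instr.apply, b4, b5]
    have q2 : output (run resultCode τ) 0 2 = C (τ.idx 11) := by
      ext <;> simp [output, resultCode, crossCode, run, Instr.apply, a2, a3]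
    have q3 : output (run resultCode τ) 0 3 = C (τ.idx 12) := by
      ext <;> simp [output, resultCode, crossCode, run, Instr.apply, b2, b3]
    refine isLargestQuadrilateral_of_cross_le hS (fun i => ?_) ?_
    · fin_cases i
      · exact q0 ▸ hc.memA _
      · exact q1 ▸ hc.memA _
      · exact q2 ▸ hc.memC _
      · exact q3 ▸ hc.memC _
    · intro a ha b hb c hc' d hd
      rw [q0, q1, q2, q3, ← hMval]
      exact hc.cross_le_of_conjugate hMall ha hb hc' hd
  · obtain ⟨g0, g1, g2, g3⟩ := cornersCode_parallelogram r40 r41 r42 r43 r52 r53 r54 r55 r56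
    exact hc.isSmallestParallelogram hD hval hcover g0 g1 g2 g3
  · have : cornersCode.length = 32 := rfl
    omega

end Sweep

/-! ### Assembly of the three phases. -/

/-- The program. -/
def calipersProgram : Program :=
  .seq splitProgram (.seq mergeProgram sweepProgram)

/-- The vertices of a polygon, repeated periodically. -/
def cyclicVertex {n : ℕ} (hn : 0 < n) (p : Fin n → ℝ × ℝ) (i : ℕ) : ℝ × ℝ :=
  p ⟨i % n, Nat.mod_lt _ hn⟩

theorem cyclicVertex_of_lt {n : ℕ} (hn : 0 < n) (p : Fin n → ℝ × ℝ) {i : ℕ} (hi : i < n) :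
    cyclicVertex hn p i = p ⟨i, hi⟩ := by
  simp only [cyclicVertex, Nat.mod_eq_of_lt hi]

theorem convexCycle_cyclicVertex {n : ℕ} (hn : 0 < n) {p : Fin n → ℝ × ℝ}
    (hp : IsVertexList p) : ConvexCycle n (cyclicVertex hn p) := by
  refine ⟨hp.1, fun i => by simp only [cyclicVertex, Nat.add_mod_right], fun i j k hij hjk hk => ?_⟩
  rw [cyclicVertex_of_lt hn p hk, cyclicVertex_of_lt hn p (hjk.trans hk),
    cyclicVertex_of_lt hn p (hij.trans (hjk.trans hk))]
  exact hp.2 _ _ _ hij hjk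

theorem range_cyclicVertex {n : ℕ} (hn : 0 < n) (p : Fin n → ℝ × ℝ) :
    Set.range (cyclicVertex hn p) = Set.range p := by
  ext x
  constructor
  · rintro ⟨i, rfl⟩
    exact ⟨_, rfl⟩
  · rintro ⟨i, rfl⟩
    exact ⟨i, cyclicVertex_of_lt hn p i.2⟩

end ConvexPolygon

theorem mainTheorem1 :
    ∃ (A : RealRAM.Program) (C : ℕ),
      ∀ (n : ℕ) (p : Fin n → ℝ × ℝ), ConvexPolygon.IsVertexList p →
        ∀ σ : RealRAM.State, ConvexPolygon.IsInput p σ →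
          ∃ (τ : RealRAM.State) (k : ℕ),
            RealRAM.Exec A σ τ k ∧ k ≤ C * n ∧
            ConvexPolygon.IsLargestQuadrilateral
              (ConvexPolygon.region p) (ConvexPolygon.output τ 0) ∧
            ConvexPolygon.IsSmallestParallelogram
              (ConvexPolygon.region p) (ConvexPolygon.output τ 8) := by
  open ConvexPolygon RealRAM in
  -- The phases cost at most (20 + 60 + 110) * n + 150 steps, and 150 ≤ 50 * n because n ≥ 3.
  refine ⟨calipersProgram, 240, fun n p hp σ hσ => ?_⟩
  have hn3 := hp.1
  have hn : 0 < n := by omega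
  have hcyc := convexCycle_cyclicVertex hn hp
  have main : Runs calipersProgram σ (fun τ k => (IsLargestQuadrilateral (region p) (output τ 0) ∧
      IsSmallestParallelogram (region p) (output τ 8)) ∧ k ≤ 240 * n) := by
    refine Runs.seq (splitProgram_spec hcyc hσ.1 fun i hi => ?_) ?_
    · rw [cyclicVertex_of_lt hn p hi]
      exact hσ.2 ⟨i, hi⟩
    rintro τ k ⟨hv, hm, hk⟩
    refine Runs.seq (mergeProgram_spec hcyc hm hv rfl) ?_
    rintro τ' k' ⟨⟨h0, hst⟩, hk'⟩
    have hc := calipers_merge hcyc hm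
    rw [range_cyclicVertex hn p] at hc
    refine (sweepProgram_spec hc (convex_convexHull ℝ _) h0 hst).mono ?_
    rintro υ l ⟨hres, hl⟩
    exact ⟨hres, by omega⟩
  obtain ⟨τ, k, he, hres, hk⟩ := main
  exact ⟨τ, k, he, hk, hres.1, hres.2⟩
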